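/- Let $0<\alpha<1$ and $\beta,d\in\mathbb R$. For a lower limit $a$ let $$[{}_aJ_t^{\alpha}f](t)=\frac1{\Gamma(\alpha)}\int_a^t(t-x)^{\alpha-1}f(x)\,dx,\qquad [{}_aD_t^{\alpha}f](t)=\frac{d}{dt}[{}_aJ_t^{1-\alpha}f](t)$$ be the Riemann–Liouville fractional integral (RLFI) and derivative (RLFD), applied to $f(x)=(x-d)^\beta$. Two kinds of lower limit are considered. (II) The lower limit is $d^+=d+\epsilon$ with $\epsilon>0$, and $t\in[d^+,d^++\epsilon)$. (I) The lower limit is $a\ne d$ and $t\in[a,a+\tfrac12|d-a|)$, where $(x-d)^\beta$ is real-valued on $[a,t]$. That is, either $a>d$, or $a<d$ and $\beta$ is an integer or a positive rational $p/q$ in lowest terms with $p$ even. For $y<0$ and $\gamma=p/q$ in lowest terms with $q$ odd, $y^{\gamma}=(-1)^p|y|^{\gamma}$. For the derivative, $t$ is moreover different from the lower limit. Below, $\frac{\Gamma(\beta+1)}{\Gamma(\beta-k+1)}$ means $\beta(\beta-1)\cdots(\beta-k+1)$ (the same number unless $\beta$ is a negative integer), and $1/\Gamma$ is $0$ at the poles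 of $\Gamma$. **1. Series and hypergeometric form.** The RLFI and the RLFD exist (the integrand is integrable, the derivative exists), and with convergent series, writing $z=(t-d)/\epsilon$ in case (II) and $z=(t-d)/(a-d)$ in case (I), $${}_{d^+}J_t^\alpha(x-d)^\beta=\sum_{k\ge0}\frac{\Gamma(\beta+1)\,\epsilon^{\beta-k}(t-d^+)^{\alpha+k}}{\Gamma(\beta-k+1)\Gamma(\alpha+k+1)}=\frac{\epsilon^{\alpha+\beta}(z-1)^\alpha}{\Gamma(\alpha+1)}\,{}_2F_1(1,-\beta;\alpha+1;1-z),$$ $${}_{a}J_t^\alpha(x-d)^\beta=\sum_{k\ge0}\frac{\Gamma(\beta+1)\,(a-d)^{\beta-k}(t-a)^{\alpha+k}}{\Gamma(\beta-k+1)\Gamma(\alpha+k+1)}=\frac{(a-d)^{\beta}(t-a)^\alpha}{\Gamma(\alpha+1)}\,{}_2F_1(1,-\beta;\alpha+1;1-z).$$ The same formulas with $\alpha$ replaced by $-\alpha$ on the right-hand sides hold for ${}_{d^+}D_t^\alpha(x-d)^\beta$ and ${}_aD_t^\alpha(x-d)^\beta$. **2. Power term plus hypergeometric term.** Let ${}_2F_1(A,B;C;\cdot)$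 also denote the principal branch, i.e. the unique holomorphic function on $\mathbb C\setminus[1,\infty)$ given by the hypergeometric series on the unit disc (part of the claim is that it exists for the parameters below). Fix a sign $\sigma\in\{1,-1\}$. For real $x>0$, ${}_2F_1(A,B;C;x)$ below is the limit of ${}_2F_1(A,B;C;w)$ as $w\to x$ with $\sigma\,\mathrm{Im}\,w>0$; for $x<1$ it is the ordinary value. The limits that occur exist. Put $(-1)^{\gamma}=e^{i\sigma\pi\gamma}$ and, for real $y<0$, $y^{\pm\alpha+\beta}=|y|^{\pm\alpha}e^{\mp i\sigma\pi\alpha}\,y^{\beta}$ with $y^\beta$ real as above. Then for either sign $\sigma$: If $\alpha+\beta\notin\mathbb Z$, $${}_{d^+}J_t^\alpha(x-d)^\beta=\frac{(-1)^\alpha\Gamma(-\alpha-\beta)}{\Gamma(-\beta)}(t-d)^{\alpha+\beta}+\frac{(-1)^\alpha\Gamma(\alpha+\beta)\,\epsilon^{\alpha+\beta}}{\Gamma(\alpha)\Gamma(\alpha+\beta+1)}\,{}_2F_1\!\Big(-\alpha-\beta,1-\alpha;1-\alpha-\beta;\frac{t-d}{\epsilon}\Big),$$ $${}_{a}J_t^\alpha(x-d)^\beta=\frac{(-1)^\alpha\Gamma(-\alpha-\beta)}{\Gamma(-\beta)}(t-d)^{\alpha+\beta}+\frac{(-1)^\alpha\Gamma(\alpha+\beta)(a-d)^{\alpha+\beta}}{\Gamma(\alpha)\Gamma(\alpha+\beta+1)}\,{}_2F_1\!\Big(-\alpha-\beta,1-\alpha;1-\alpha-\beta;\frac{t-d}{a-d}\Big).$$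 If $-\alpha+\beta\notin\mathbb Z$, $${}_{d^+}D_t^\alpha(x-d)^\beta=\frac{(-1)^{-\alpha}\Gamma(\alpha-\beta)}{\Gamma(-\beta)}(t-d)^{-\alpha+\beta}+\frac{(-1)^{-\alpha}\Gamma(-\alpha+\beta)\,\epsilon^{-\alpha+\beta}}{\Gamma(-\alpha)\Gamma(-\alpha+\beta+1)}\,{}_2F_1\!\Big(\alpha-\beta,1+\alpha;1+\alpha-\beta;\frac{t-d}{\epsilon}\Big),$$ $${}_{a}D_t^\alpha(x-d)^\beta=\frac{(-1)^{-\alpha}\Gamma(\alpha-\beta)}{\Gamma(-\beta)}(t-d)^{-\alpha+\beta}+\frac{(-1)^{-\alpha}\Gamma(-\alpha+\beta)(a-d)^{-\alpha+\beta}}{\Gamma(-\alpha)\Gamma(-\alpha+\beta+1)}\,{}_2F_1\!\Big(\alpha-\beta,1+\alpha;1+\alpha-\beta;\frac{t-d}{a-d}\Big).$$ -/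

import Mathlib

open scoped Topology

/-- The real power `x ^ β`. For `x ≥ 0` it is the usual one. For `x < 0` and `β = p / q` in lowest
terms with `q` odd, it is the `q`-th real root of `x ^ p`, that is `(-1) ^ p * |x| ^ β`; in
particular it is the integer power when `β` is an integer. For `x < 0` and all other `β` the value
is irrelevant: such `x` are outside `powerDomain`. -/
noncomputable def realPow (x β : ℝ) : ℝ :=
  open Classical in
  if x < 0 ∧ ∃ r : ℚ, β = r ∧ Odd r.num ∧ Odd r.den then -(|x| ^ β) else |x| ^ β

/-- The power function `x ↦ (x - d) ^ β`. -/
noncomputable def powerFun (d β : ℝ) (x : ℝ) : ℝ := realPow (x - d) β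

/-- The set on which `x ↦ (x - d) ^ β` is defined as a real-valued function: always the points
`x > d`; the point `d` for rational `β ≥ 0`; the points `x < d` when `β` is an integer or a positive
rational number whose numerator in lowest terms is even. -/
def powerDomain (d β : ℝ) : Set ℝ :=
  {x | d < x ∨
    (x = d ∧ ∃ r : ℚ, β = r ∧ 0 ≤ r) ∨
    (x < d ∧ ((∃ m : ℤ, β = m) ∨ ∃ r : ℚ, β = r ∧ 0 < r ∧ Even r.num))}

/-- The integrand of the Riemann-Liouville fractional integral. -/
noncomputable def rlKernel (α : ℝ) (f : ℝ → ℝ) (t x : ℝ) : ℝ := (t - x) ^ (α - 1) * f x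

/-- The (left) Riemann-Liouville fractional integral of order `α > 0` with lower limit `a`. -/
noncomputable def rlIntegral (α a : ℝ) (f : ℝ → ℝ) (t : ℝ) : ℝ :=
  1 / Real.Gamma α * ∫ x in a..t, rlKernel α f t x

/-- The (left) Riemann-Liouville fractional derivative of order `α > 0` with lower limit `a`:
the `n`-th derivative of the fractional integral of order `n - α`, where `n = ⌊α⌋ + 1`. -/
noncomputable def rlDeriv (α a : ℝ) (f : ℝ → ℝ) (t : ℝ) : ℝ :=
  iteratedDeriv (⌊α⌋₊ + 1) (rlIntegral ((⌊α⌋₊ + 1 : ℕ) - α) a f) t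

/-- The ratio `Γ(β + 1) / Γ(β - k + 1)`, written as the descending Pochhammer symbol
`β (β - 1) ⋯ (β - k + 1)`, so that it also makes sense when `β` is a negative integer. -/
noncomputable def gammaRatio (β : ℝ) (k : ℕ) : ℝ := ∏ i ∈ Finset.range k, (β - i)

theorem gammaRatio_eq (β : ℝ) (hβ : ∀ m : ℕ, β ≠ -(m + 1)) (k : ℕ) :
    gammaRatio β k = Real.Gamma (β + 1) / Real.Gamma (β - k + 1) := by
  induction k with
  | zero =>
    have h : Real.Gamma (β + 1) ≠ 0 := by
      refine Real.Gamma_ne_zero fun m hm => hβ m ?_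
      linarith
    simp [gammaRatio, h]
  | succ k ih =>
    have hs : gammaRatio β (k + 1) = gammaRatio β k * (β - k) := by
      simp [gammaRatio, Finset.prod_range_succ]
    have he : β - ((k + 1 : ℕ) : ℝ) + 1 = β - k := by push_cast; ring
    rw [hs, ih, he]
    by_cases h0 : β - k = 0
    · simp [h0]
    · rw [Real.Gamma_add_one h0]
      field_simp

/-- `F` is the principal branch of the Gauss hypergeometric function with parameters `a, b; c`:
the (unique) holomorphic function on `ℂ ∖ [1, ∞)` given by the hypergeometric series on the open
unit disc. -/
def IsPrincipalBranch (a b c : ℂ) (F : ℂ → ℂ) : Prop :=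
  DifferentiableOn ℂ F {z : ℂ | 1 - z ∈ Complex.slitPlane} ∧
    ∀ z : ℂ, ‖z‖ < 1 → F z = ₂F₁ a b c z

/-- `v` is the boundary value `F(x + i σ 0)` at the real point `x`: the limit of `F` from the upper
half-plane if `σ = 1`, and from the lower half-plane if `σ = -1`. -/
def IsSideValue (F : ℂ → ℂ) (σ x : ℝ) (v : ℂ) : Prop :=
  Filter.Tendsto F (𝓝[{w : ℂ | 0 < σ * w.im}] (x : ℂ)) (𝓝 v)

/-- `(-1) ^ γ` with `arg (-1) = σ π`. -/
noncomputable def negOnePow (σ γ : ℝ) : ℂ :=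
  Complex.exp (((σ * Real.pi * γ : ℝ) : ℂ) * Complex.I)

/-- `x ^ (γ + β) = x ^ γ * x ^ β` for a real number `x ≠ 0`, where `x ^ β` is the real power and
`x ^ γ` is formed with `arg x = 0` for `x > 0` and `arg x = -σ π` for `x < 0`. -/
noncomputable def sidePow (σ x γ β : ℝ) : ℂ :=
  (if x < 0 then negOnePow (-σ) γ else 1) * ((|x| ^ γ : ℝ) : ℂ) * ((realPow x β : ℝ) : ℂ)

/-! Write `b = a - d` and `s = t - a`, with `b = ε` in case (II). Since `s < |b|`, the factor `1 +
(x - a) / b` is positive on `[a, t]`, so the real power splits as `(x - d) ^ β = b ^ β * (1 + (x -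
a) / b) ^ β`. Expanding the second factor by the binomial series and integrating termwise against
`(t - x) ^ (α - 1)` produces beta integrals, which assemble into `b ^ β * s ^ α / Γ(α + 1) * ₂F₁ 1
(-β) (α + 1) (-s / b)` (`integral_sub_rpow_mul_rpow`). Differentiating such an expression lowers its
exponent by one (`hasDerivAt_rpow_mul_hypergeometric`), so order `1 - α` becomes `-α`: integral and
derivative have the same form, with a parameter `a = ±α > -1`.

The second form is a connection formula at `1`. Put `A = -a - β`. The principal branch `F` of `₂F₁ A
(1 - a) (A + 1)` satisfies, off the real axis near `1`, `F z = Γ(1 + A) Γ(a) / Γ(A + a) * z ^ (-A) -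
A / a * (1 - z) ^ a * ₂F₁ 1 (A + a) (a + 1) (1 - z)`. At `z = (t - d) / b` one has `1 - z = -s / b`
and `A + a = -β`, so the last factor is the series of the first form; taking boundary values and
solving for it gives the claim (`IsHypergeometricContinuation.exists_isSideValue`).

For `A, a > 1`, `F` is Euler's integral. Both sides of the connection formula solve `z y' + A y = A
(1 - z) ^ (a - 1)`, so their difference is a multiple of `z ^ (-A)` on each half disc at `1`; the
limit at `1`, a beta value, shows that it is zero. Contiguous relations then lower `A` and `a` by
integers, which reaches all parameters needed, in particular `a = -α < 0`. -/

/-! ### Hypergeometric and binomial series on the unit disc -/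

section HypergeometricSeries

open Filter

variable {𝕜 : Type*}

/-- The coefficients of the hypergeometric series. -/
noncomputable def hgCoeff [Field 𝕜] (a b c : 𝕜) (n : ℕ) : 𝕜 := ordinaryHypergeometricCoefficient a b c n

theorem hgCoeff_zero [Field 𝕜] (a b c : 𝕜) :
    hgCoeff a b c 0 = 1 := by
  simp [hgCoeff, ordinaryHypergeometricCoefficient]

theorem hgCoeff_succ [Field 𝕜] (a b c : 𝕜) (n : ℕ) :
    hgCoeff a b c (n + 1) =
      hgCoeff a b c n * ((a + n) * (b + n) / ((c + n) * (n + 1))) := by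
  simp only [hgCoeff, ordinaryHypergeometricCoefficient, ascPochhammer_succ_eval, Nat.factorial_succ,
    Nat.cast_mul, Nat.cast_add, Nat.cast_one, mul_inv, div_eq_mul_inv]
  ring

/-- Ratio test: consecutive coefficients have ratio tending to `1`. The weight `n + 1` makes the
same bound serve the termwise derivative. No condition on `c` is needed, because with `0⁻¹ = 0` the
coefficients vanish beyond a zero of `c + n`. -/
theorem summable_norm_hgCoeff [RCLike 𝕜] (a b c : 𝕜) {r : ℝ} (h0 : 0 ≤ r)
    (h1 : r < 1) :
    Summable fun n : ℕ => (n + 1) * ‖hgCoeff a b c n‖ * r ^ n := by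
  obtain ⟨s, hs, hs1⟩ := exists_between h1
  refine summable_of_ratio_norm_eventually_le hs1 ?_
  have hlim : Tendsto (fun n : ℕ => ((2 + 1 * (n : ℝ)) / (1 + 1 * (n : ℝ))) *
      ‖(a + 1 * (n : 𝕜)) / (c + 1 * (n : 𝕜)) * ((b + 1 * (n : 𝕜)) / (1 + 1 * (n : 𝕜)))‖ * r) atTop
      (𝓝 (1 / 1 * ‖(1 : 𝕜) / 1 * (1 / 1)‖ * r)) :=
    ((tendsto_add_mul_div_add_mul_atTop_nhds _ _ _ one_ne_zero).mul
      (((tendsto_add_mul_div_add_mul_atTop_nhds _ _ _ one_ne_zero).mul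
      (tendsto_add_mul_div_add_mul_atTop_nhds _ _ _ one_ne_zero)).norm)).mul_const r
  have hev := hlim.eventually_lt_const (u := s) (by simpa using hs)
  filter_upwards [hev] with n hn
  rw [hgCoeff_succ, Real.norm_of_nonneg (by positivity),
    Real.norm_of_nonneg (by positivity)]
  have e : (((n + 1 : ℕ) : ℝ) + 1) * ‖hgCoeff a b c n *
      ((a + n) * (b + n) / ((c + n) * (n + 1)))‖ * r ^ (n + 1) =
      (((2 + 1 * (n : ℝ)) / (1 + 1 * (n : ℝ))) *
      ‖(a + 1 * (n : 𝕜)) / (c + 1 * (n : 𝕜)) * ((b + 1 * (n : 𝕜)) / (1 + 1 * (n : 𝕜)))‖ * r) *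
      ((n + 1) * ‖hgCoeff a b c n‖ * r ^ n) := by
    have h : (1 + (n : ℝ)) ≠ 0 := by positivity
    have e1 : (a + n) * (b + n) / ((c + n) * ((n : 𝕜) + 1)) =
        (a + 1 * (n : 𝕜)) / (c + 1 * (n : 𝕜)) * ((b + 1 * (n : 𝕜)) / (1 + 1 * (n : 𝕜))) := by
      simp only [div_eq_mul_inv, mul_inv]; ring
    rw [e1, norm_mul]
    push_cast
    field_simp
    ring
  rw [e]
  exact mul_le_mul_of_nonneg_right hn.le (by positivity)

theorem hasSum_hypergeometric [RCLike 𝕜] (a b c : 𝕜) {z : 𝕜} (hz : ‖z‖ < 1) :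
    HasSum (fun n : ℕ => hgCoeff a b c n * z ^ n) (₂F₁ a b c z) := by
  rw [ordinaryHypergeometric_eq_tsum]
  refine Summable.hasSum ?_
  refine Summable.of_norm_bounded
    (summable_norm_hgCoeff a b c (norm_nonneg z) hz) fun n => ?_
  simp only [norm_mul, norm_pow]
  refine mul_le_mul_of_nonneg_right ?_ (by positivity)
  exact le_mul_of_one_le_left (by positivity) (by simp)

theorem hypergeometric_eq_of_hasSum [RCLike 𝕜] {a b c : 𝕜} {z w : 𝕜} (hz : ‖z‖ < 1)
    (h : HasSum (fun n : ℕ => hgCoeff a b c n * z ^ n) w) :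
    ₂F₁ a b c z = w :=
  (hasSum_hypergeometric a b c hz).unique h

theorem summable_norm_hypergeometric [RCLike 𝕜] (a b c : 𝕜) {z : 𝕜} (hz : ‖z‖ < 1) :
    Summable fun n : ℕ => ‖hgCoeff a b c n * z ^ n‖ := by
  refine Summable.of_norm_bounded
    (summable_norm_hgCoeff a b c (norm_nonneg z) hz) fun n => ?_
  simp only [norm_mul, norm_pow, norm_norm]
  refine mul_le_mul_of_nonneg_right ?_ (by positivity)
  exact le_mul_of_one_le_left (by positivity) (by simp)

/-- Termwise differentiation of the hypergeometric series, multiplied by the variable. -/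
theorem hasDerivAt_hypergeometric [RCLike 𝕜] (a b c : 𝕜) {z : 𝕜} (hz : ‖z‖ < 1) :
    ∃ D, HasDerivAt (₂F₁ a b c : 𝕜 → 𝕜) D z ∧
      HasSum (fun n : ℕ => n * hgCoeff a b c n * z ^ n) (z * D) := by
  obtain ⟨r, hr, hr1⟩ := exists_between hz
  have h0 : 0 < r := (norm_nonneg z).trans_lt hr
  have hS := (summable_norm_hgCoeff a b c h0.le hr1).mul_left r⁻¹
  have hb : ∀ n : ℕ, ∀ y ∈ Metric.ball (0 : 𝕜) r,
      ‖hgCoeff a b c n * (n * y ^ (n - 1))‖ ≤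
      r⁻¹ * ((n + 1) * ‖hgCoeff a b c n‖ * r ^ n) := by
    intro n y hy
    rw [mem_ball_zero_iff] at hy
    rcases n with _ | n
    · simp; positivity
    · simp only [norm_mul, norm_pow, RCLike.norm_natCast, Nat.add_sub_cancel, pow_succ]
      have : ‖y‖ ^ n ≤ r ^ n := pow_le_pow_left₀ (norm_nonneg _) hy.le n
      rw [show r⁻¹ * ((((n + 1 : ℕ) : ℝ) + 1) * ‖hgCoeff a b c (n + 1)‖ *
        (r ^ n * r)) = ‖hgCoeff a b c (n + 1)‖ *
        ((((n + 1 : ℕ) : ℝ) + 1) * r ^ n) by field_simp]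
      gcongr
      linarith
  have hd := hasDerivAt_tsum_of_isPreconnected
    (g := fun (n : ℕ) (y : 𝕜) => hgCoeff a b c n * y ^ n)
    (g' := fun (n : ℕ) (y : 𝕜) => hgCoeff a b c n * (n * y ^ (n - 1)))
    (y₀ := z) (y := z) hS
    Metric.isOpen_ball (convex_ball (0 : 𝕜) r).isPreconnected
    (fun n y _ => (hasDerivAt_pow n y).const_mul _) hb (by simpa using hr)
    (hasSum_hypergeometric a b c hz).summable (by simpa using hr)
  refine ⟨∑' n : ℕ, hgCoeff a b c n * (n * z ^ (n - 1)), ?_, ?_⟩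
  · rw [ordinaryHypergeometric_eq_tsum]
    exact hd
  · have hs : Summable fun n : ℕ =>
        hgCoeff a b c n * (n * z ^ (n - 1)) :=
      Summable.of_norm_bounded hS fun n => hb n z (by simpa using hr)
    refine (hs.hasSum.mul_left z).congr_fun ?_
    intro n
    rcases n with _ | n
    · simp
    · simp only [Nat.add_sub_cancel, pow_succ]; ring

theorem continuousAt_hypergeometric [RCLike 𝕜] (a b c : 𝕜) {z : 𝕜} (hz : ‖z‖ < 1) :
    ContinuousAt (₂F₁ a b c : 𝕜 → 𝕜) z := by
  obtain ⟨D, hD, -⟩ := hasDerivAt_hypergeometric a b c hz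
  exact hD.continuousAt

/-- This is `(q)_n / (q + 1)_n = q / (q + n)`: on series, `q + z d/dz` lowers the third parameter
from `q + 1` to `q`. -/
theorem add_natCast_mul_hgCoeff [Field 𝕜] [CharZero 𝕜] (a b : 𝕜) {q : 𝕜}
    (hq : ∀ n : ℕ, q + n ≠ 0) (n : ℕ) :
    (q + n) * hgCoeff a b (q + 1) n =
      q * hgCoeff a b q n := by
  induction n with
  | zero => simp [hgCoeff_zero]
  | succ n ih =>
    rw [hgCoeff_succ, hgCoeff_succ, ← mul_assoc q, ← ih]
    have h1 := hq n
    have h2 := hq (n + 1)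
    have h3 : q + 1 + (n : 𝕜) ≠ 0 := by
      intro h; apply h2; push_cast; rw [← h]; ring
    have h4 : (n : 𝕜) + 1 ≠ 0 := Nat.cast_add_one_ne_zero n
    push_cast at h2 ⊢
    field_simp
    ring

/-- The derivative of `z ^ q * ₂F₁ a b (q + 1) z` is `q * z ^ (q - 1) * ₂F₁ a b q z`. -/
theorem hasDerivAt_hypergeometric_lower [RCLike 𝕜] (a b : 𝕜) {q : 𝕜}
    (hq : ∀ n : ℕ, q + n ≠ 0) {z : 𝕜} (hz : ‖z‖ < 1) :
    ∃ D, HasDerivAt (₂F₁ a b (q + 1) : 𝕜 → 𝕜) D z ∧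
      q * ₂F₁ a b (q + 1) z + z * D = q * ₂F₁ a b q z := by
  obtain ⟨D, hD, hs⟩ := hasDerivAt_hypergeometric a b (q + 1) hz
  refine ⟨D, hD, ?_⟩
  refine (((hasSum_hypergeometric a b (q + 1) hz).mul_left q).add hs).unique ?_
  refine ((hasSum_hypergeometric a b q hz).mul_left q).congr_fun ?_
  intro n
  have := add_natCast_mul_hgCoeff a b hq n
  linear_combination z ^ n * this

/-- With both other parameters `1` the coefficients are `(a)_n / n!`, those of `(1 - z) ^ (-a)`;
binomial coefficients are written this way throughout. -/
theorem hgCoeff_one_one [Field 𝕜] [CharZero 𝕜] (a : 𝕜) (n : ℕ) :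
    hgCoeff a 1 1 (n + 1) =
      hgCoeff a 1 1 n * ((a + n) / (n + 1)) := by
  rw [hgCoeff_succ]
  have h4 : (n : 𝕜) + 1 ≠ 0 := Nat.cast_add_one_ne_zero n
  rw [add_comm (1 : 𝕜)]
  field_simp

theorem add_natCast_mul_hgCoeff_one_one [Field 𝕜] [CharZero 𝕜] (a : 𝕜) (n : ℕ) :
    (a + n) * hgCoeff a 1 1 n =
      a * hgCoeff (a + 1) 1 1 n := by
  induction n with
  | zero => simp [hgCoeff_zero]
  | succ n ih =>
    rw [hgCoeff_one_one, hgCoeff_one_one, ← mul_assoc a, ← ih]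
    push_cast
    ring

theorem hgCoeff_self_add_one [Field 𝕜] [CharZero 𝕜] (b : 𝕜) {a : 𝕜}
    (ha : ∀ n : ℕ, a + n ≠ 0) (n : ℕ) :
    hgCoeff a b (a + 1) n =
      a / (a + n) * hgCoeff b 1 1 n := by
  induction n with
  | zero => simp [hgCoeff_zero, show a ≠ 0 by simpa using ha 0]
  | succ n ih =>
    rw [hgCoeff_succ, hgCoeff_one_one, ih]
    have h1 := ha n
    have h2 := ha (n + 1)
    have h4 : (n : 𝕜) + 1 ≠ 0 := Nat.cast_add_one_ne_zero n
    push_cast at h2 ⊢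
    rw [show a + 1 + (n : 𝕜) = a + (n + 1) by ring]
    field_simp

theorem binomialSeries_apply_eq_hgCoeff [RCLike 𝕜] (a w : 𝕜) (n : ℕ) :
    (binomialSeries 𝕜 a n fun _ => w) = hgCoeff (-a) 1 1 n * (-w) ^ n := by
  have := binomialSeries_eq_ordinaryHypergeometricSeries (𝔸 := 𝕜) (a := a) (b := 1)
    (fun k hk => by
      have h := Nat.cast_add_one_ne_zero (R := 𝕜) k
      rw [hk] at h
      simp at h)
  rw [this, FormalMultilinearSeries.compContinuousLinearMap_apply]
  exact ordinaryHypergeometricSeries_apply_eq (-a) 1 1 (-w) n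

theorem hasSum_one_add_rpow (β : ℝ) {w : ℝ} (hw : |w| < 1) :
    HasSum (fun n : ℕ => hgCoeff (-β) 1 1 n * (-w) ^ n) ((1 + w) ^ β) := by
  have h := (Real.one_add_rpow_hasFPowerSeriesOnBall_zero (a := β)).hasSum (y := w)
    (by simpa [enorm_eq_nnnorm, ← NNReal.coe_lt_coe] using hw)
  simp only [zero_add] at h
  exact h.congr_fun fun n => (binomialSeries_apply_eq_hgCoeff β w n).symm

theorem hasSum_one_sub_cpow (a : ℂ) {z : ℂ} (hz : ‖z‖ < 1) :
    HasSum (fun n : ℕ => hgCoeff (-a) 1 1 n * z ^ n) ((1 - z) ^ a) := by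
  have h := (Complex.one_add_cpow_hasFPowerSeriesOnBall_zero (a := a)).hasSum (y := -z)
    (by simpa [enorm_eq_nnnorm, ← NNReal.coe_lt_coe] using hz)
  rw [zero_add, ← sub_eq_add_neg] at h
  exact h.congr_fun fun n => by rw [binomialSeries_apply_eq_hgCoeff, neg_neg]

theorem hypergeometric_ofReal (a b c x : ℝ) :
    ((₂F₁ a b c x : ℝ) : ℂ) = ₂F₁ (a : ℂ) (b : ℂ) (c : ℂ) (x : ℂ) := by
  have h : ∀ (p : ℝ) (n : ℕ), (ascPochhammer ℂ n).eval (p : ℂ) =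
      (((ascPochhammer ℝ n).eval p : ℝ) : ℂ) := by
    intro p n
    induction n with
    | zero => simp
    | succ n ih => simp [ascPochhammer_succ_eval, ih]
  simp only [ordinaryHypergeometric_eq_tsum, Complex.ofReal_tsum, h, smul_eq_mul]
  push_cast
  rfl

end HypergeometricSeries

/-! ### Termwise fractional integration of the binomial series -/

section FractionalIntegral

open MeasureTheory intervalIntegral

theorem intervalIntegrable_sub_rpow {α : ℝ} (hα : 0 < α) (a t : ℝ) :
    IntervalIntegrable (fun x => (t - x) ^ (α - 1)) volume a t := by
  have h := (intervalIntegrable_rpow' (a := t - a) (b := 0) (r := α - 1)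
    (by linarith)).comp_sub_left t
  simpa using h

theorem integral_sub_rpow_mul_pow {α : ℝ} (hα : 0 < α) (k : ℕ) {a t : ℝ} (hat : a ≤ t) :
    ∫ x in a..t, (t - x) ^ (α - 1) * (x - a) ^ k =
      (t - a) ^ (α + k) * (k.factorial * Real.Gamma α / Real.Gamma (α + k + 1)) := by
  have hsub : ∫ x in a..t, (t - x) ^ (α - 1) * (x - a) ^ k =
      ∫ x in (0 : ℝ)..(t - a), x ^ k * (t - a - x) ^ (α - 1) := by
    rw [← sub_self a, ← integral_comp_sub_right
      (fun x => x ^ k * (t - a - x) ^ (α - 1)) a]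
    refine integral_congr fun x _ => ?_
    rw [sub_sub_sub_cancel_right, mul_comm]
  rw [hsub]
  rcases hat.eq_or_lt with rfl | hlt
  · have : α + k ≠ 0 := by positivity
    simp [Real.zero_rpow this]
  set s := t - a with hs
  have hs0 : 0 < s := sub_pos.2 hlt
  -- The integral is a scaled `B(k + 1, α)`, and `Complex.betaIntegral` is complex-valued.
  apply Complex.ofReal_injective
  rw [← intervalIntegral.integral_ofReal]
  have hk : 0 < ((k : ℂ) + 1).re := by
    simp only [Complex.add_re, Complex.natCast_re, Complex.one_re]
    positivity
  have hα' : 0 < (α : ℂ).re := by simpa using hα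
  have h := Complex.betaIntegral_scaled ((k : ℂ) + 1) α hs0
  rw [Complex.betaIntegral_eq_Gamma_mul_div _ _ hk hα', Complex.Gamma_nat_eq_factorial] at h
  have e : ∫ x in (0 : ℝ)..s, ((x ^ k * (s - x) ^ (α - 1) : ℝ) : ℂ) =
      ∫ x in (0 : ℝ)..s, (x : ℂ) ^ ((k : ℂ) + 1 - 1) * ((s : ℂ) - x) ^ ((α : ℂ) - 1) := by
    refine integral_congr fun x hx => ?_
    rw [Set.uIcc_of_le hs0.le] at hx
    simp only [add_sub_cancel_right, Complex.cpow_natCast]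
    rw [Complex.ofReal_mul, Complex.ofReal_cpow (sub_nonneg.2 hx.2)]
    push_cast
    rfl
  rw [e, h, Complex.ofReal_mul, Complex.ofReal_cpow hs0.le]
  push_cast
  rw [← Complex.Gamma_ofReal, ← Complex.Gamma_ofReal]
  push_cast
  rw [show (k : ℂ) + 1 + α - 1 = α + k by ring, show (k : ℂ) + 1 + α = α + k + 1 by ring]

/-- Converts a binomial coefficient times a beta value into a coefficient of `₂F₁ 1 b q`; both sides
are `(b)_k * Γ(q)`, up to `Γ(q + k) = (q)_k * Γ(q)`. -/
theorem hgCoeff_one_mul_Gamma (b : ℝ) {q : ℝ} (hq : 0 < q) (k : ℕ) :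
    hgCoeff b 1 1 k * (k.factorial * Real.Gamma q) =
      hgCoeff 1 b q k * Real.Gamma (q + k) := by
  induction k with
  | zero => simp [hgCoeff_zero]
  | succ k ih =>
    have h : q + k ≠ 0 := by positivity
    rw [hgCoeff_one_one, hgCoeff_succ, Nat.factorial_succ, Nat.cast_add_one, ← add_assoc,
      Real.Gamma_add_one h]
    push_cast
    have h4 : (k : ℝ) + 1 ≠ 0 := by positivity
    rw [add_comm (1 : ℝ) k]
    field_simp
    linear_combination (b + k) * ih

theorem gammaRatio_eq_hgCoeff (β : ℝ) (k : ℕ) :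
    gammaRatio β k = (-1) ^ k * k.factorial * hgCoeff (-β) 1 1 k := by
  induction k with
  | zero => simp [gammaRatio, hgCoeff_zero]
  | succ k ih =>
    have h : gammaRatio β (k + 1) = gammaRatio β k * (β - k) := by
      simp [gammaRatio, Finset.prod_range_succ]
    rw [h, ih, hgCoeff_one_one, Nat.factorial_succ]
    have h4 : (k : ℝ) + 1 ≠ 0 := by positivity
    push_cast
    field_simp
    ring

theorem one_add_div_pos {b y s : ℝ} (hy0 : 0 ≤ y) (hys : y ≤ s) (hs : s < |b|) :
    0 < 1 + y / b := by
  have h : |y / b| < 1 := by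
    rw [abs_div, abs_of_nonneg hy0, div_lt_one (by linarith)]
    linarith
  linarith [(abs_lt.1 h).1]

theorem intervalIntegrable_sub_rpow_mul_rpow {α : ℝ} (hα : 0 < α) (β : ℝ) {a b t : ℝ}
    (hat : a ≤ t) (ht : t - a < |b|) :
    IntervalIntegrable (fun x => (t - x) ^ (α - 1) * (1 + (x - a) / b) ^ β) volume a t := by
  refine (intervalIntegrable_sub_rpow hα a t).mul_continuousOn ?_
  rw [Set.uIcc_of_le hat]
  refine ContinuousOn.rpow_const (by fun_prop) fun x hx => Or.inl ?_
  exact (one_add_div_pos (sub_nonneg.2 hx.1) (sub_le_sub_right hx.2 a) ht).ne'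

theorem integral_sub_rpow_mul_rpow {α : ℝ} (hα : 0 < α) (β : ℝ) {a b t : ℝ}
    (hat : a ≤ t) (ht : t - a < |b|) :
    1 / Real.Gamma α * ∫ x in a..t, (t - x) ^ (α - 1) * (1 + (x - a) / b) ^ β =
      (t - a) ^ α / Real.Gamma (α + 1) * ₂F₁ 1 (-β) (α + 1) (-((t - a) / b)) := by
  have hs0 : 0 ≤ t - a := sub_nonneg.2 hat
  have hb : 0 < |b| := hs0.trans_lt ht
  have hw : |(t - a) / b| < 1 := by
    rw [abs_div, abs_of_nonneg hs0, div_lt_one hb]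
    exact ht
  have hx1 : ∀ x ∈ Set.uIoc a t, |(x - a) / b| ≤ |(t - a) / b| := by
    intro x hx
    rw [Set.uIoc_of_le hat] at hx
    rw [abs_div, abs_div, abs_of_nonneg hs0, abs_of_nonneg (by linarith [hx.1])]
    gcongr
    exact hx.2
  have hsum := hasSum_integral_of_dominated_convergence (μ := volume) (a := a) (b := t)
    (F := fun (k : ℕ) x => (t - x) ^ (α - 1) * (hgCoeff (-β) 1 1 k * (-((x - a) / b)) ^ k))
    (f := fun x => (t - x) ^ (α - 1) * (1 + (x - a) / b) ^ β)
    -- The dominating terms freeze the binomial factor at the endpoint `x = t`, where the series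
    -- still converges absolutely, and keep the integrable singularity.
    (fun k x => (t - x) ^ (α - 1) * ‖hgCoeff (-β) 1 1 k * (-((t - a) / b)) ^ k‖)
    (fun k => ((intervalIntegrable_sub_rpow hα a t).mul_continuousOn
      (g := fun x => hgCoeff (-β) 1 1 k * (-((x - a) / b)) ^ k)
      (by fun_prop)).aestronglyMeasurable_restrict_uIoc)
    (fun k => Filter.Eventually.of_forall fun x hx => by
      have h := hx1 x hx
      rw [Set.uIoc_of_le hat] at hx
      have h0 : 0 ≤ (t - x) ^ (α - 1) := Real.rpow_nonneg (sub_nonneg.2 hx.2) _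
      rw [norm_mul, Real.norm_of_nonneg h0]
      refine mul_le_mul_of_nonneg_left ?_ h0
      rw [norm_mul, norm_mul, norm_pow, norm_pow, norm_neg, norm_neg]
      gcongr
      exact h)
    (Filter.Eventually.of_forall fun x _ =>
      (summable_norm_hypergeometric (-β) 1 1 (by rwa [norm_neg, Real.norm_eq_abs])).mul_left _)
    (by
      simp_rw [tsum_mul_left]
      exact (intervalIntegrable_sub_rpow hα a t).mul_const _)
    (Filter.Eventually.of_forall fun x hx =>
      (hasSum_one_add_rpow β ((hx1 x hx).trans_lt hw)).mul_left _)
  refine (hsum.mul_left (1 / Real.Gamma α)).unique ?_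
  refine ((hasSum_hypergeometric 1 (-β) (α + 1) (z := -((t - a) / b))
    (by rwa [norm_neg, Real.norm_eq_abs])).mul_left ((t - a) ^ α / Real.Gamma (α + 1))).congr_fun ?_
  intro k
  have e : ∀ x, (t - x) ^ (α - 1) * (hgCoeff (-β) 1 1 k * (-((x - a) / b)) ^ k) =
      (hgCoeff (-β) 1 1 k * (-1 / b) ^ k) * ((t - x) ^ (α - 1) * (x - a) ^ k) := by
    intro x
    rw [show -((x - a) / b) = (-1 / b) * (x - a) by ring, mul_pow]
    ring
  simp_rw [e]
  rw [intervalIntegral.integral_const_mul, integral_sub_rpow_mul_pow hα k hat,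
    Real.rpow_add_natCast' hs0 (by positivity)]
  have h1 := hgCoeff_one_mul_Gamma (-β) (q := α + 1) (by linarith) k
  rw [show α + 1 + (k : ℝ) = α + k + 1 by ring] at h1
  have g1 : Real.Gamma α ≠ 0 := (Real.Gamma_pos_of_pos hα).ne'
  have g2 : Real.Gamma (α + 1) ≠ 0 := (Real.Gamma_pos_of_pos (by positivity)).ne'
  have g3 : Real.Gamma (α + k + 1) ≠ 0 := (Real.Gamma_pos_of_pos (by positivity)).ne'
  rw [show -((t - a) / b) = (-1 / b) * (t - a) by ring, mul_pow]
  field_simp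
  linear_combination (t - a) ^ α * (-1 / b) ^ k * (t - a) ^ k * h1

/-- The expansion of `s ^ a * ₂F₁ 1 (-β) (a + 1) (-s / b)` in powers of `s`. -/
theorem hasSum_gammaRatio {a : ℝ} (ha : 0 < a + 1) (β C : ℝ) {b s : ℝ} (hs0 : 0 ≤ s)
    (hsa : 0 < s ∨ 0 < a) (hs : s < |b|) :
    HasSum (fun k : ℕ => gammaRatio β k * (C / b ^ k) * s ^ (a + k) / Real.Gamma (a + k + 1))
      (C * (s ^ a / Real.Gamma (a + 1) * ₂F₁ 1 (-β) (a + 1) (-(s / b)))) := by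
  have hb : 0 < |b| := hs0.trans_lt hs
  have hw : |s / b| < 1 := by
    rw [abs_div, abs_of_nonneg hs0, div_lt_one hb]
    exact hs
  refine (((hasSum_hypergeometric 1 (-β) (a + 1) (z := -(s / b))
    (by rwa [norm_neg, Real.norm_eq_abs])).mul_left (s ^ a / Real.Gamma (a + 1))).mul_left C).congr_fun ?_
  intro k
  have h1 := hgCoeff_one_mul_Gamma (-β) ha k
  rw [show a + 1 + (k : ℝ) = a + k + 1 by ring] at h1
  have g2 : Real.Gamma (a + 1) ≠ 0 := (Real.Gamma_pos_of_pos ha).ne'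
  have g3 : Real.Gamma (a + k + 1) ≠ 0 := by
    refine (Real.Gamma_pos_of_pos ?_).ne'
    have : (0 : ℝ) ≤ k := k.cast_nonneg
    linarith
  have hpow : s ^ (a + k) = s ^ a * s ^ k := by
    rcases hsa with h | h
    · exact Real.rpow_add_natCast h.ne' _ _
    · exact Real.rpow_add_natCast' hs0 (by positivity)
  have hb0 : b ≠ 0 := abs_pos.1 hb
  rw [gammaRatio_eq_hgCoeff, hpow, show -(s / b) = (-1) * (s * b⁻¹) by ring, mul_pow, mul_pow,
    inv_pow]
  field_simp
  linear_combination s ^ a * s ^ k * C * h1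

theorem hasDerivAt_rpow_mul_hypergeometric {q : ℝ} (hq : 0 < q) (β : ℝ) {b s : ℝ} (hs0 : 0 < s)
    (hs : s < |b|) :
    HasDerivAt (fun s => s ^ q / Real.Gamma (q + 1) * ₂F₁ 1 (-β) (q + 1) (-(s / b)))
      (s ^ (q - 1) / Real.Gamma q * ₂F₁ 1 (-β) q (-(s / b))) s := by
  have hb : 0 < |b| := hs0.trans hs
  have hw : ‖-(s / b)‖ < 1 := by
    rw [norm_neg, Real.norm_eq_abs, abs_div, abs_of_nonneg hs0.le, div_lt_one hb]
    exact hs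
  obtain ⟨D, hD, hDe⟩ := hasDerivAt_hypergeometric_lower 1 (-β) (q := q)
    (fun n => by positivity) hw
  have h1 : HasDerivAt (fun s : ℝ => -(s / b)) (-(1 / b)) s := ((hasDerivAt_id s).div_const b).neg
  have h2 := ((Real.hasDerivAt_rpow_const (p := q) (Or.inl hs0.ne')).div_const
    (Real.Gamma (q + 1))).mul (hD.comp s h1)
  refine h2.congr_deriv ?_
  -- With `s ^ (q - 1)` pulled out, the product rule leaves `q * F + z * F'`, which is `q` times the
  -- series with third parameter `q`; that `q` cancels against `Γ(q + 1) = q * Γ(q)`.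
  rw [Real.Gamma_add_one hq.ne', show s ^ q = s ^ (q - 1) * s by
    rw [← Real.rpow_add_one hs0.ne', sub_add_cancel]]
  have g1 : Real.Gamma q ≠ 0 := (Real.Gamma_pos_of_pos hq).ne'
  field_simp
  simp only [Function.comp_apply]
  linear_combination hDe

end FractionalIntegral

/-! ### Real powers and the fractional integral and derivative of `(x - d) ^ β` -/

section PowerFunction

open MeasureTheory intervalIntegral

theorem realPow_of_pos {x : ℝ} (hx : 0 < x) (β : ℝ) : realPow x β = x ^ β := by
  rw [realPow, if_neg fun h => hx.not_gt h.1, abs_of_pos hx]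

theorem realPow_mul_of_pos (x : ℝ) {w : ℝ} (hw : 0 < w) (β : ℝ) :
    realPow (x * w) β = realPow x β * w ^ β := by
  have h1 : |x * w| ^ β = |x| ^ β * w ^ β := by
    rw [abs_mul, abs_of_pos hw, Real.mul_rpow (abs_nonneg x) hw.le]
  have h2 : x * w < 0 ↔ x < 0 := by
    rw [mul_neg_iff]
    constructor
    · rintro (h | h)
      · exact absurd hw h.2.not_gt
      · exact h.1
    · exact fun h => Or.inr ⟨h, hw⟩
  simp only [realPow]
  by_cases h : x < 0 ∧ ∃ r : ℚ, β = r ∧ Odd r.num ∧ Odd r.den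
  · rw [if_pos ⟨h2.2 h.1, h.2⟩, if_pos h, h1, neg_mul]
  · rw [if_neg fun h' => h ⟨h2.1 h'.1, h'.2⟩, if_neg h, h1]

/-- For `x < 0`, subtracting `1` from a rational exponent keeps its denominator. When this is odd,
the parity of the numerator flips, so the sign changes exactly as under division by `x`. -/
theorem realPow_sub_one {x : ℝ} (hx : x ≠ 0) {β : ℝ}
    (h : 0 < x ∨ ∃ r : ℚ, β = r ∧ Odd r.den) : realPow x (β - 1) = realPow x β / x := by
  rcases hx.lt_or_gt with hneg | hpos
  · obtain ⟨r, rfl, hr⟩ := h.resolve_left hneg.not_gt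
    have hden : (r - 1).den = r.den := by simp
    have hnum : (r - 1).num = r.num - r.den := by
      have h1 := Rat.mul_den_eq_num (r - 1)
      rw [hden, sub_mul, Rat.mul_den_eq_num, one_mul] at h1
      exact_mod_cast h1.symm
    have hodd : Odd (r - 1).num ↔ ¬ Odd r.num := by
      rw [hnum, Int.odd_sub]
      have : ¬ Even (r.den : ℤ) := by
        rwa [Int.even_coe_nat, Nat.not_even_iff_odd]
      tauto
    have key : ∀ q : ℚ, (∃ r' : ℚ, (q : ℝ) = r' ∧ Odd r'.num ∧ Odd r'.den) ↔
        Odd q.num ∧ Odd q.den := by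
      intro q
      constructor
      · rintro ⟨r', h1, h2⟩
        rw [Rat.cast_inj.1 h1]
        exact h2
      · exact fun h => ⟨q, rfl, h⟩
    have hc : ((r : ℝ) - 1) = ((r - 1 : ℚ) : ℝ) := by push_cast; ring
    have habs : |x| ^ (((r - 1 : ℚ)) : ℝ) = |x| ^ (r : ℝ) / |x| := by
      rw [← hc, Real.rpow_sub_one (abs_pos.2 hx).ne']
    rw [hc]
    simp only [realPow, key, hneg, true_and, hden, hr, and_true, hodd, habs]
    rw [abs_of_neg hneg]
    split_ifs <;> field_simp
  · rw [realPow_of_pos hpos, realPow_of_pos hpos, Real.rpow_sub_one hx]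

theorem realPow_sub_natCast {x : ℝ} (hx : x ≠ 0) {β : ℝ}
    (h : 0 < x ∨ ∃ r : ℚ, β = r ∧ Odd r.den) (k : ℕ) :
    realPow x (β - k) = realPow x β / x ^ k := by
  induction k with
  | zero => simp
  | succ k ih =>
    have h' : 0 < x ∨ ∃ r : ℚ, β - k = r ∧ Odd r.den := by
      rcases h with h | ⟨r, rfl, hr⟩
      · exact Or.inl h
      · refine Or.inr ⟨r - k, by push_cast; ring, ?_⟩
        have hden : (r - k).den = r.den := by simp
        rwa [hden]
    rw [show β - ((k + 1 : ℕ) : ℝ) = β - k - 1 by push_cast; ring, realPow_sub_one hx h', ih,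
      pow_succ, div_div]

theorem odd_den_of_mem_powerDomain {d β a : ℝ} (hd : a ≠ d) (h : a ∈ powerDomain d β) :
    0 < a - d ∨ ∃ r : ℚ, β = r ∧ Odd r.den := by
  rcases h with h | h | ⟨-, ⟨m, rfl⟩ | ⟨r, hr, -, he⟩⟩
  · exact Or.inl (sub_pos.2 h)
  · exact absurd h.1 hd
  · exact Or.inr ⟨m, by simp, by simp⟩
  · refine Or.inr ⟨r, hr, ?_⟩
    rw [← Nat.not_even_iff_odd]
    intro hden
    -- In lowest terms an even numerator forces an odd denominator.
    have h2 : 2 ∣ Nat.gcd r.num.natAbs r.den :=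
      Nat.dvd_gcd (Int.natAbs_dvd_natAbs.2 he.two_dvd) hden.two_dvd
    rw [r.reduced] at h2
    omega

theorem powerFun_eq_mul_rpow (d β : ℝ) {a t x : ℝ} (hx : x ∈ Set.Icc a t)
    (ht : t - a < |a - d|) :
    powerFun d β x = realPow (a - d) β * (1 + (x - a) / (a - d)) ^ β := by
  have hpos := one_add_div_pos (sub_nonneg.2 hx.1) (sub_le_sub_right hx.2 a) ht
  have hb : a - d ≠ 0 := by
    rw [← abs_pos]
    linarith [hx.1, hx.2]
  rw [powerFun, ← realPow_mul_of_pos _ hpos]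
  congr 1
  field_simp
  ring

theorem intervalIntegrable_rlKernel_powerFun {α : ℝ} (hα : 0 < α) (β d : ℝ) {a t : ℝ}
    (hat : a ≤ t) (ht : t - a < |a - d|) :
    IntervalIntegrable (rlKernel α (powerFun d β) t) volume a t := by
  refine ((intervalIntegrable_sub_rpow_mul_rpow hα β hat ht).const_mul
    (realPow (a - d) β)).congr fun x hx => ?_
  rw [Set.uIoc_of_le hat] at hx
  simp only [rlKernel]
  rw [powerFun_eq_mul_rpow d β ⟨hx.1.le, hx.2⟩ ht]
  ring

theorem rlIntegral_powerFun {α : ℝ} (hα : 0 < α) (β d : ℝ) {a t : ℝ}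
    (hat : a ≤ t) (ht : t - a < |a - d|) :
    rlIntegral α a (powerFun d β) t = realPow (a - d) β *
      ((t - a) ^ α / Real.Gamma (α + 1) * ₂F₁ 1 (-β) (α + 1) (-((t - a) / (a - d)))) := by
  rw [← integral_sub_rpow_mul_rpow hα β hat ht, rlIntegral, mul_left_comm]
  congr 1
  rw [← intervalIntegral.integral_const_mul]
  apply intervalIntegral.integral_congr
  intro x hx
  rw [Set.uIcc_of_le hat] at hx
  simp only [rlKernel]
  rw [powerFun_eq_mul_rpow d β hx ht]
  ring

theorem hasDerivAt_rlIntegral_powerFun {α : ℝ} (hα : α < 1) (β d : ℝ) {a t : ℝ}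
    (hat : a < t) (ht : t - a < |a - d|) :
    HasDerivAt (rlIntegral (1 - α) a (powerFun d β)) (realPow (a - d) β *
      ((t - a) ^ (-α) / Real.Gamma (-α + 1) *
        ₂F₁ 1 (-β) (-α + 1) (-((t - a) / (a - d))))) t := by
  have h := ((hasDerivAt_rpow_mul_hypergeometric (q := 1 - α) (by linarith) β (b := a - d)
    (sub_pos.2 hat) ht).comp t ((hasDerivAt_id t).sub_const a)).const_mul (realPow (a - d) β)
  rw [show 1 - α - 1 = -α by ring, show (1 - α : ℝ) = -α + 1 by ring, mul_one] at h
  rw [show (1 - α : ℝ) = -α + 1 by ring]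
  refine h.congr_of_eventuallyEq ?_
  -- The closed form holds on a whole neighbourhood of `t`, so its derivative is that of the
  -- fractional integral.
  filter_upwards [Ioo_mem_nhds hat (show t < a + |a - d| by linarith)] with x hx
  rw [rlIntegral_powerFun (by linarith) β d hx.1.le (by linarith [hx.2])]
  rfl

theorem rlDeriv_eq_deriv {α : ℝ} (hα₁ : α < 1) (a : ℝ) (f : ℝ → ℝ) (t : ℝ) :
    rlDeriv α a f t = deriv (rlIntegral (1 - α) a f) t := by
  have h : ⌊α⌋₊ = 0 := Nat.floor_eq_zero.2 hα₁
  simp [rlDeriv, h, iteratedDeriv_one]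

theorem rlDeriv_powerFun {α : ℝ} (hα₁ : α < 1) (β d : ℝ) {a t : ℝ}
    (hat : a < t) (ht : t - a < |a - d|) :
    rlDeriv α a (powerFun d β) t = realPow (a - d) β *
      ((t - a) ^ (-α) / Real.Gamma (-α + 1) *
        ₂F₁ 1 (-β) (-α + 1) (-((t - a) / (a - d)))) := by
  rw [rlDeriv_eq_deriv hα₁, (hasDerivAt_rlIntegral_powerFun hα₁ β d hat ht).deriv]

end PowerFunction

/-! ### Euler's integral on the cut plane -/

section EulerIntegral

open MeasureTheory intervalIntegral

/-- The complex plane cut along `[1, ∞)`. -/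
def cutPlane : Set ℂ := {z : ℂ | 1 - z ∈ Complex.slitPlane}

theorem isOpen_cutPlane : IsOpen cutPlane :=
  Complex.isOpen_slitPlane.preimage (by fun_prop : Continuous fun z : ℂ => 1 - z)

/-- The cut plane is star-shaped about `0`, so the integrand of Euler's integral never meets the
branch cut. -/
theorem one_sub_mul_mem_slitPlane {z : ℂ} (hz : z ∈ cutPlane) {u : ℝ} (hu : u ∈ Set.Icc (0 : ℝ) 1) :
    1 - z * u ∈ Complex.slitPlane := by
  have hz' : 1 - z ∈ Complex.slitPlane := hz
  rw [Complex.mem_slitPlane_iff] at hz' ⊢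
  simp only [Complex.sub_re, Complex.one_re, Complex.sub_im, Complex.one_im, zero_sub, ne_eq,
    neg_eq_zero, Complex.mul_re, Complex.ofReal_re, Complex.ofReal_im, mul_zero, sub_zero,
    Complex.mul_im, zero_add] at hz' ⊢
  rcases hu.1.eq_or_lt with rfl | h0
  · simp
  · rcases hz' with h | h
    · left
      nlinarith [hu.2]
    · right
      exact mul_ne_zero h h0.ne'

theorem mem_cutPlane_of_im_ne_zero {z : ℂ} (hz : z.im ≠ 0) : z ∈ cutPlane := by
  refine Complex.mem_slitPlane_iff.2 (Or.inr ?_)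
  simpa using hz

/-- Euler's integral for the hypergeometric function with parameters `A, 1 - a; A + 1`. -/
noncomputable def eulerIntegral (A a : ℝ) (z : ℂ) : ℂ :=
  A * ∫ u in (0 : ℝ)..1, ((u ^ (A - 1) : ℝ) : ℂ) * (1 - z * u) ^ ((a - 1 : ℝ) : ℂ)

theorem continuousOn_eulerIntegrand {A : ℝ} (hA : 1 < A) (c : ℂ) {s : Set (ℂ × ℝ)}
    (hs : ∀ p ∈ s, p.1 ∈ cutPlane ∧ p.2 ∈ Set.Icc (0 : ℝ) 1) :
    ContinuousOn (fun p : ℂ × ℝ => ((p.2 ^ (A - 1) : ℝ) : ℂ) * (1 - p.1 * p.2) ^ c) s := by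
  refine ContinuousOn.mul ?_ ?_
  · refine Complex.continuous_ofReal.comp_continuousOn ?_
    exact continuousOn_snd.rpow_const fun p _ => Or.inr (by linarith)
  · refine ContinuousOn.cpow ?_ continuousOn_const ?_
    · exact (continuous_const.sub (continuous_fst.mul
        (Complex.continuous_ofReal.comp continuous_snd))).continuousOn
    · exact fun p hp => one_sub_mul_mem_slitPlane (hs p hp).1 (hs p hp).2

theorem continuousOn_eulerIntegrand_right {A : ℝ} (hA : 1 < A) (c : ℂ) {z : ℂ} (hz : z ∈ cutPlane) :
    ContinuousOn (fun u : ℝ => ((u ^ (A - 1) : ℝ) : ℂ) * (1 - z * u) ^ c) (Set.uIcc 0 1) := by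
  rw [Set.uIcc_of_le zero_le_one]
  exact (continuousOn_eulerIntegrand hA c (s := {z} ×ˢ Set.Icc (0 : ℝ) 1)
    (fun p hp => ⟨by rw [hp.1]; exact hz, hp.2⟩)).comp (by fun_prop : ContinuousOn
      (fun u : ℝ => (z, u)) (Set.Icc 0 1)) (fun u hu => ⟨rfl, hu⟩)

theorem hasDerivAt_eulerIntegral_aux {A : ℝ} (hA : 1 < A) (a : ℝ) {z : ℂ} (hz : z ∈ cutPlane) :
    HasDerivAt (eulerIntegral A a) (A * ∫ u in (0 : ℝ)..1, ((u ^ (A - 1) : ℝ) : ℂ) *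
      (((a - 1 : ℝ) : ℂ) * (1 - z * u) ^ (((a - 1 : ℝ) : ℂ) - 1) * (-u))) z := by
  obtain ⟨r, hr, hball⟩ := Metric.isOpen_iff.1 isOpen_cutPlane z hz
  have hcl : Metric.closedBall z (r / 2) ⊆ cutPlane :=
    (Metric.closedBall_subset_ball (by linarith)).trans hball
  have hcont : ContinuousOn (fun p : ℂ × ℝ => (((p.2 ^ (A - 1) : ℝ) : ℂ) *
      (1 - p.1 * p.2) ^ (((a - 1 : ℝ) : ℂ) - 1)) * (((a - 1 : ℝ) : ℂ) * (-p.2)))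
      (Metric.closedBall z (r / 2) ×ˢ Set.Icc (0 : ℝ) 1) := by
    refine (continuousOn_eulerIntegrand hA _ fun p hp => ⟨hcl hp.1, hp.2⟩).mul ?_
    exact (continuous_const.mul (Complex.continuous_ofReal.comp continuous_snd).neg).continuousOn
  -- Compactness gives a constant dominating the `z`-derivative of the integrand near `z`.
  obtain ⟨C, hC⟩ := ((isCompact_closedBall z (r / 2)).prod
    (isCompact_Icc (a := (0 : ℝ)) (b := 1))).exists_bound_of_continuousOn hcont
  have hsub : Set.uIoc (0 : ℝ) 1 ⊆ Set.Icc 0 1 := by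
    rw [Set.uIoc_of_le zero_le_one]; exact Set.Ioc_subset_Icc_self
  refine HasDerivAt.const_mul (A : ℂ) ?_
  refine (intervalIntegral.hasDerivAt_integral_of_dominated_loc_of_deriv_le (𝕜 := ℂ) (μ := volume)
    (F := fun z (u : ℝ) => ((u ^ (A - 1) : ℝ) : ℂ) * (1 - z * u) ^ ((a - 1 : ℝ) : ℂ))
    (F' := fun z (u : ℝ) => ((u ^ (A - 1) : ℝ) : ℂ) *
      (((a - 1 : ℝ) : ℂ) * (1 - z * u) ^ (((a - 1 : ℝ) : ℂ) - 1) * (-u)))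
    (bound := fun _ => C) (Metric.closedBall_mem_nhds z (half_pos hr)) ?_ ?_ ?_ ?_ ?_ ?_).2
  · filter_upwards [isOpen_cutPlane.mem_nhds hz] with w hw
    exact (continuousOn_eulerIntegrand_right hA _ hw).intervalIntegrable.aestronglyMeasurable_restrict_uIoc
  · exact (continuousOn_eulerIntegrand_right hA _ hz).intervalIntegrable
  · have h : ContinuousOn (fun u : ℝ => ((u ^ (A - 1) : ℝ) : ℂ) *
        (1 - z * u) ^ (((a - 1 : ℝ) : ℂ) - 1) * (((a - 1 : ℝ) : ℂ) * (-u))) (Set.uIcc 0 1) :=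
      (continuousOn_eulerIntegrand_right hA _ hz).mul
        (continuous_const.mul Complex.continuous_ofReal.neg).continuousOn
    refine (h.congr fun u _ => ?_).intervalIntegrable.aestronglyMeasurable_restrict_uIoc
    ring
  · refine Filter.Eventually.of_forall fun u hu w hw => ?_
    have h := hC (w, u) ⟨hw, hsub hu⟩
    refine le_trans (le_of_eq ?_) h
    congr 1
    ring
  · exact intervalIntegrable_const
  · refine Filter.Eventually.of_forall fun u hu w hw => ?_
    have h1 : HasDerivAt (fun w : ℂ => 1 - w * u) (-u) w := by
      simpa using ((hasDerivAt_id w).mul_const (u : ℂ)).const_sub 1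
    exact (h1.cpow_const (one_sub_mul_mem_slitPlane (hcl hw) (hsub hu))).const_mul _

theorem differentiableOn_eulerIntegral {A : ℝ} (hA : 1 < A) (a : ℝ) :
    DifferentiableOn ℂ (eulerIntegral A a) cutPlane := fun _ hz =>
  (hasDerivAt_eulerIntegral_aux hA a hz).differentiableAt.differentiableWithinAt

/-- The differential equation `z F' + A F = A (1 - z) ^ (a - 1)`. -/
theorem hasDerivAt_eulerIntegral {A : ℝ} (hA : 1 < A) (a : ℝ) {z : ℂ} (hz : z ∈ cutPlane) :
    ∃ D, HasDerivAt (eulerIntegral A a) D z ∧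
      z * D + A * eulerIntegral A a z = A * (1 - z) ^ ((a - 1 : ℝ) : ℂ) := by
  refine ⟨_, hasDerivAt_eulerIntegral_aux hA a hz, ?_⟩
  have hc1 := continuousOn_eulerIntegrand_right hA ((a - 1 : ℝ) : ℂ) hz
  have hc2 : ContinuousOn (fun u : ℝ => ((u ^ (A - 1) : ℝ) : ℂ) *
      (((a - 1 : ℝ) : ℂ) * (1 - z * u) ^ (((a - 1 : ℝ) : ℂ) - 1) * (-u))) (Set.uIcc 0 1) := by
    refine ((continuousOn_eulerIntegrand_right hA (((a - 1 : ℝ) : ℂ) - 1) hz).mul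
      (g := fun u : ℝ => ((a - 1 : ℝ) : ℂ) * (-(u : ℂ)))
      (continuous_const.mul Complex.continuous_ofReal.neg).continuousOn).congr fun u _ => ?_
    simp only [Pi.mul_apply]
    ring
  -- Integrating the `u`-derivative of `u ^ A * (1 - z * u) ^ (a - 1)` over `[0, 1]` gives the
  -- differential equation; the boundary term at `0` vanishes and the one at `1` is its right-hand
  -- side, up to the factor `A`.
  have hder : ∀ u ∈ Set.Ioo (0 : ℝ) 1, HasDerivAt
      (fun u : ℝ => ((u ^ A : ℝ) : ℂ) * (1 - z * u) ^ ((a - 1 : ℝ) : ℂ))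
      (z * (((u ^ (A - 1) : ℝ) : ℂ) *
        (((a - 1 : ℝ) : ℂ) * (1 - z * u) ^ (((a - 1 : ℝ) : ℂ) - 1) * (-u))) +
        A * (((u ^ (A - 1) : ℝ) : ℂ) * (1 - z * u) ^ ((a - 1 : ℝ) : ℂ))) u := by
    intro u hu
    have h1 : HasDerivAt (fun u : ℝ => ((u ^ A : ℝ) : ℂ)) ((A * u ^ (A - 1) : ℝ) : ℂ) u :=
      (Real.hasDerivAt_rpow_const (Or.inl hu.1.ne')).ofReal_comp
    have h2 : HasDerivAt (fun w : ℂ => (1 - z * w) ^ ((a - 1 : ℝ) : ℂ))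
        (((a - 1 : ℝ) : ℂ) * (1 - z * u) ^ (((a - 1 : ℝ) : ℂ) - 1) * (-z)) u := by
      have h3 : HasDerivAt (fun w : ℂ => 1 - z * w) (-z) (u : ℂ) := by
        simpa using ((hasDerivAt_id (u : ℂ)).const_mul z).const_sub 1
      exact h3.cpow_const (one_sub_mul_mem_slitPlane hz ⟨hu.1.le, hu.2.le⟩)
    refine (h1.mul h2.comp_ofReal).congr_deriv ?_
    rw [show u ^ A = u ^ (A - 1) * u by rw [← Real.rpow_add_one hu.1.ne', sub_add_cancel]]
    push_cast
    ring
  have hcont : ContinuousOn (fun u : ℝ => ((u ^ A : ℝ) : ℂ) * (1 - z * u) ^ ((a - 1 : ℝ) : ℂ))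
      (Set.Icc 0 1) := by
    have := continuousOn_eulerIntegrand_right (A := A + 1) (by linarith) ((a - 1 : ℝ) : ℂ) hz
    rwa [Set.uIcc_of_le zero_le_one, add_sub_cancel_right] at this
  have h := integral_eq_sub_of_hasDerivAt_of_le zero_le_one hcont hder
    ((hc2.intervalIntegrable.const_mul z).add (hc1.intervalIntegrable.const_mul (A : ℂ)))
  rw [intervalIntegral.integral_add (hc2.intervalIntegrable.const_mul z)
    (hc1.intervalIntegrable.const_mul (A : ℂ)), intervalIntegral.integral_const_mul,
    intervalIntegral.integral_const_mul] at h
  simp only [Real.one_rpow, Complex.ofReal_one, mul_one, one_mul,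
    Real.zero_rpow (show A ≠ 0 by linarith), Complex.ofReal_zero, zero_mul, sub_zero] at h
  rw [← h, eulerIntegral]
  ring

theorem eulerIntegral_eq_hypergeometric {A : ℝ} (hA : 1 < A) (a : ℝ) {z : ℂ} (hz : ‖z‖ < 1) :
    eulerIntegral A a z = ₂F₁ (A : ℂ) ((1 - a : ℝ) : ℂ) ((A + 1 : ℝ) : ℂ) z := by
  have hle : ∀ u ∈ Set.uIoc (0 : ℝ) 1, ‖z * u‖ ≤ ‖z‖ := by
    intro u hu
    rw [Set.uIoc_of_le zero_le_one] at hu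
    rw [norm_mul, Complex.norm_real, Real.norm_of_nonneg hu.1.le]
    exact mul_le_of_le_one_right (norm_nonneg z) hu.2
  have hcoe : (((a - 1 : ℝ) : ℂ)) = -((1 - a : ℝ) : ℂ) := by push_cast; ring
  -- These moments supply the factor `A / (A + k)` that separates the coefficients of `₂F₁ A (1 - a)
  -- (A + 1)` from binomial ones.
  have hint : ∀ k : ℕ, ∫ u in (0 : ℝ)..1, (u ^ (A - 1) * u ^ k : ℝ) = 1 / (A + k) := by
    intro k
    have hk : (0 : ℝ) ≤ k := k.cast_nonneg
    have : ∫ u in (0 : ℝ)..1, (u ^ (A - 1) * u ^ k : ℝ) =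
        ∫ u in (0 : ℝ)..1, u ^ (A - 1 + k) := by
      refine intervalIntegral.integral_congr fun u hu => ?_
      rw [Set.uIcc_of_le zero_le_one] at hu
      exact (Real.rpow_add_natCast' hu.1 (by linarith)).symm
    rw [this, integral_rpow (Or.inl (by linarith)), Real.one_rpow,
      Real.zero_rpow (by linarith), show A - 1 + k + 1 = A + k by ring, sub_zero]
  have hsum := hasSum_integral_of_dominated_convergence (μ := volume) (a := (0 : ℝ)) (b := 1)
    (F := fun (k : ℕ) (u : ℝ) => ((u ^ (A - 1) : ℝ) : ℂ) *
      (hgCoeff ((1 - a : ℝ) : ℂ) 1 1 k * (z * u) ^ k))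
    (f := fun u : ℝ => ((u ^ (A - 1) : ℝ) : ℂ) * (1 - z * u) ^ ((a - 1 : ℝ) : ℂ))
    (fun k _ => ‖hgCoeff ((1 - a : ℝ) : ℂ) 1 1 k * z ^ k‖)
    (fun k => by
      refine (Continuous.aestronglyMeasurable ?_)
      refine (Complex.continuous_ofReal.comp
        (Real.continuous_rpow_const (by linarith))).mul (by fun_prop))
    (fun k => Filter.Eventually.of_forall fun u hu => by
      have h := hle u hu
      rw [Set.uIoc_of_le zero_le_one] at hu
      rw [norm_mul, Complex.norm_real, Real.norm_of_nonneg (Real.rpow_nonneg hu.1.le _)]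
      refine (mul_le_of_le_one_left (norm_nonneg _)
        (Real.rpow_le_one hu.1.le hu.2 (by linarith))).trans ?_
      rw [norm_mul, norm_mul, norm_pow, norm_pow]
      gcongr)
    (Filter.Eventually.of_forall fun x _ => summable_norm_hypergeometric _ _ _ hz)
    intervalIntegrable_const
    (Filter.Eventually.of_forall fun u hu => by
      have h := hasSum_one_sub_cpow ((a - 1 : ℝ) : ℂ) ((hle u hu).trans_lt hz)
      rw [hcoe, neg_neg, ← hcoe] at h
      exact h.mul_left _)
  refine (hsum.mul_left (A : ℂ)).unique ?_
  refine (hasSum_hypergeometric _ _ _ hz).congr_fun fun k => ?_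
  have e : ∀ u : ℝ, ((u ^ (A - 1) : ℝ) : ℂ) * (hgCoeff ((1 - a : ℝ) : ℂ) 1 1 k * (z * u) ^ k) =
      (hgCoeff ((1 - a : ℝ) : ℂ) 1 1 k * z ^ k) * ((u ^ (A - 1) * u ^ k : ℝ) : ℂ) := by
    intro u
    push_cast
    ring
  have hne : ∀ n : ℕ, (A : ℂ) + n ≠ 0 := fun n => by
    norm_cast
    positivity
  simp_rw [e]
  rw [intervalIntegral.integral_const_mul, intervalIntegral.integral_ofReal, hint,
    Complex.ofReal_add, Complex.ofReal_one, hgCoeff_self_add_one _ hne]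
  push_cast
  ring

end EulerIntegral

/-! ### Contiguous relations, by comparison of coefficients -/

section Contiguous

variable {𝕜 : Type*}

theorem mul_hgCoeff_add_one [Field 𝕜] [CharZero 𝕜] (a b c : 𝕜) (n : ℕ) :
    b * hgCoeff a (b + 1) c n = (b + n) * hgCoeff a b c n := by
  induction n with
  | zero => simp [hgCoeff_zero]
  | succ n ih =>
    rw [hgCoeff_succ, hgCoeff_succ, ← mul_assoc, ih]
    push_cast
    ring

theorem hgCoeff_one_succ [Field 𝕜] [CharZero 𝕜] (b c : 𝕜) (n : ℕ) :
    hgCoeff 1 b c (n + 1) = hgCoeff 1 b c n * ((b + n) / (c + n)) := by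
  rw [hgCoeff_succ]
  have h4 : (n : 𝕜) + 1 ≠ 0 := Nat.cast_add_one_ne_zero n
  rw [add_comm (1 : 𝕜) n, mul_comm (c + (n : 𝕜)), mul_div_mul_left _ _ h4]

theorem hasSum_hypergeometric_succ [RCLike 𝕜] (a b c : 𝕜) {z : 𝕜} (hz : ‖z‖ < 1) :
    HasSum (fun n : ℕ => hgCoeff a b c (n + 1) * z ^ (n + 1)) (₂F₁ a b c z - 1) := by
  have h := (hasSum_nat_add_iff' 1).2 (hasSum_hypergeometric a b c hz)
  simpa [hgCoeff_zero] using h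

/-- Yields the differential equation for the second term of the connection formula, with `u = 1 -
z`. -/
theorem one_sub_mul_hypergeometric_sub [RCLike 𝕜] (A : 𝕜) {a : 𝕜} (ha : ∀ n : ℕ, a + n ≠ 0)
    {u : 𝕜} (hu : ‖u‖ < 1) :
    (1 - u) * (a * ₂F₁ 1 (A + a) a u) - A * u * ₂F₁ 1 (A + a) (a + 1) u = a := by
  have h : a * (₂F₁ 1 (A + a) a u - 1) =
      u * (a * ₂F₁ 1 (A + a) a u + A * ₂F₁ 1 (A + a) (a + 1) u) := by
    refine ((hasSum_hypergeometric_succ 1 (A + a) a hu).mul_left a).unique ?_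
    refine ((((hasSum_hypergeometric 1 (A + a) a hu).mul_left a).add
      ((hasSum_hypergeometric 1 (A + a) (a + 1) hu).mul_left A)).mul_left u).congr_fun fun n => ?_
    have h1 := add_natCast_mul_hgCoeff 1 (A + a) ha n
    have h2 : a * hgCoeff 1 (A + a) a (n + 1) = hgCoeff 1 (A + a) (a + 1) n * (A + a + n) := by
      rw [hgCoeff_one_succ, ← mul_assoc, ← h1]
      have := ha n
      field_simp
    rw [pow_succ]
    linear_combination u ^ n * u * (h2 + h1)
  linear_combination h

/-- Carries the connection formula from `A + 1` to `A` on the side of the expansion at `1`;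
`hypergeometric_eq_one_add` does the same for `a`. -/
theorem add_mul_hypergeometric_eq [RCLike 𝕜] (A : 𝕜) {a : 𝕜} (ha : ∀ n : ℕ, a + n ≠ 0)
    {u : 𝕜} (hu : ‖u‖ < 1) :
    a + A * ₂F₁ 1 (A + a) (a + 1) u = (A + a) * (1 - u) * ₂F₁ 1 (A + 1 + a) (a + 1) u := by
  have h : A * (₂F₁ 1 (A + a) (a + 1) u - 1) =
      (A + a) * ((₂F₁ 1 (A + 1 + a) (a + 1) u - 1) - u * ₂F₁ 1 (A + 1 + a) (a + 1) u) := by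
    refine ((hasSum_hypergeometric_succ 1 (A + a) (a + 1) hu).mul_left A).unique ?_
    refine (((hasSum_hypergeometric_succ 1 (A + 1 + a) (a + 1) hu).sub
      ((hasSum_hypergeometric 1 (A + 1 + a) (a + 1) hu).mul_left u)).mul_left
        (A + a)).congr_fun fun n => ?_
    have h1 := mul_hgCoeff_add_one 1 (A + a) (a + 1) n
    have h2 := mul_hgCoeff_add_one 1 (A + a) (a + 1) (n + 1)
    have h3 := hgCoeff_one_succ (A + a) (a + 1) n
    have hne : a + 1 + (n : 𝕜) ≠ 0 := by
      have := ha (n + 1)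
      push_cast at this
      rwa [show a + 1 + (n : 𝕜) = a + (n + 1) by ring]
    rw [show A + a + 1 = A + 1 + a by ring] at h1 h2
    have h4 : hgCoeff 1 (A + a) (a + 1) (n + 1) * (a + 1 + n) =
        hgCoeff 1 (A + a) (a + 1) n * (A + a + n) := by
      rw [h3]
      field_simp
    push_cast at h2
    rw [pow_succ]
    linear_combination u ^ n * u * (h1 - h2 - h4)
  linear_combination h

theorem hypergeometric_eq_one_add [RCLike 𝕜] (b : 𝕜) {c : 𝕜} (hc : ∀ n : ℕ, c + n ≠ 0)
    {u : 𝕜} (hu : ‖u‖ < 1) :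
    ₂F₁ 1 b c u = 1 + b / c * u * ₂F₁ 1 (b + 1) (c + 1) u := by
  have h : ₂F₁ 1 b c u - 1 = b / c * u * ₂F₁ 1 (b + 1) (c + 1) u := by
    refine (hasSum_hypergeometric_succ 1 b c hu).unique ?_
    refine ((hasSum_hypergeometric 1 (b + 1) (c + 1) hu).mul_left (b / c * u)).congr_fun
      fun n => ?_
    have h1 := mul_hgCoeff_add_one 1 b c n
    have h2 := add_natCast_mul_hgCoeff 1 (b + 1) hc n
    have h3 := hgCoeff_one_succ b c n
    have hn := hc n
    have h0 : c ≠ 0 := by simpa using hc 0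
    rw [h3, pow_succ]
    field_simp
    linear_combination u ^ n * u * (-c * h1 - b * h2)
  linear_combination h

/-- The right-hand side makes sense on the whole cut plane once the function with `A + 1` is
continued there, so this relation defines the continuation for `A`. The next theorem plays this role
for `a`. -/
theorem hypergeometric_eq_one_sub_cpow_add {A a : ℂ} (hA : ∀ n : ℕ, A + n ≠ 0) {z : ℂ}
    (hz : ‖z‖ < 1) :
    ₂F₁ A (1 - a) (A + 1) z =
      (1 - z) ^ a + (A + a) / (A + 1) * z * ₂F₁ (A + 1) (1 - a) (A + 1 + 1) z := by
  have hA1 : ∀ n : ℕ, A + 1 + n ≠ 0 := fun n => by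
    have := hA (n + 1)
    push_cast at this
    rwa [add_assoc, add_comm (1 : ℂ)]
  have hb := (hasSum_nat_add_iff' 1).2 (hasSum_one_sub_cpow a hz)
  simp only [Finset.range_one, Finset.sum_singleton, hgCoeff_zero, pow_zero, mul_one] at hb
  have h : ₂F₁ A (1 - a) (A + 1) z - 1 = ((1 - z) ^ a - 1) +
      (A + a) / (A + 1) * z * ₂F₁ (A + 1) (1 - a) (A + 1 + 1) z := by
    refine (hasSum_hypergeometric_succ A (1 - a) (A + 1) hz).unique ?_
    refine (hb.add ((hasSum_hypergeometric (A + 1) (1 - a) (A + 1 + 1) hz).mul_left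
      ((A + a) / (A + 1) * z))).congr_fun fun n => ?_
    have h1 := add_natCast_mul_hgCoeff_one_one (-a) n
    rw [show -a + 1 = 1 - a by ring] at h1
    have h2 : hgCoeff (-a) 1 1 (n + 1) * (n + 1) = -a * hgCoeff (1 - a) 1 1 n := by
      rw [hgCoeff_one_one, ← h1]
      have h4 : (n : ℂ) + 1 ≠ 0 := Nat.cast_add_one_ne_zero n
      field_simp
    have h4 : (n : ℂ) + 1 ≠ 0 := Nat.cast_add_one_ne_zero n
    have h5 := hA1 n
    have h6 : A + 1 ≠ 0 := by simpa using hA1 0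
    rw [hgCoeff_self_add_one _ hA, hgCoeff_self_add_one _ hA1, hgCoeff_one_one (1 - a),
      eq_div_of_mul_eq h4 h2]
    push_cast
    rw [show A + ((n : ℂ) + 1) = A + 1 + n by ring, pow_succ]
    field_simp
    ring
  linear_combination h

theorem hypergeometric_eq_neg_one_sub_cpow_add {A a : ℂ} (hA : ∀ n : ℕ, A + n ≠ 0) (ha : a ≠ 0)
    {z : ℂ} (hz : ‖z‖ < 1) :
    ₂F₁ A (1 - a) (A + 1) z =
      -(A / a) * (1 - z) ^ a + (A + a) / a * ₂F₁ A (1 - (a + 1)) (A + 1) z := by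
  refine hypergeometric_eq_of_hasSum hz ?_
  refine (((hasSum_one_sub_cpow a hz).mul_left (-(A / a))).add
    ((hasSum_hypergeometric A (1 - (a + 1)) (A + 1) hz).mul_left ((A + a) / a))).congr_fun
    fun n => ?_
  have h1 := add_natCast_mul_hgCoeff_one_one (-a) n
  rw [show -a + 1 = 1 - a by ring] at h1
  have h2 := hA n
  rw [hgCoeff_self_add_one _ hA, hgCoeff_self_add_one _ hA, show 1 - (a + 1) = -a by ring]
  field_simp
  linear_combination (A * z ^ n) * h1

end Contiguous

/-! ### The connection formula at `1` -/

section ConnectionFormula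

open MeasureTheory intervalIntegral

/-- The coefficient of the power term in the connection formula at `1`. -/
noncomputable def connectionConst (A a : ℝ) : ℝ :=
  Real.Gamma (1 + A) * Real.Gamma a / Real.Gamma (A + a)

/-- Holds at the poles too, where `Real.Gamma` is `0` and so is its inverse. Hence the recursions
for `connectionConst` include `A + a = -β` with `β` a natural number. -/
theorem inv_Gamma_eq_self_mul (x : ℝ) : (Real.Gamma x)⁻¹ = x * (Real.Gamma (x + 1))⁻¹ := by
  rcases eq_or_ne x 0 with rfl | h
  · simp
  · rw [Real.Gamma_add_one h]
    field_simp

theorem connectionConst_add_one_left {A : ℝ} (hA : A + 1 ≠ 0) (a : ℝ) :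
    connectionConst A a = (A + a) / (A + 1) * connectionConst (A + 1) a := by
  rw [connectionConst, connectionConst, div_eq_mul_inv, inv_Gamma_eq_self_mul (A + a),
    show 1 + (A + 1) = (A + 1) + 1 by ring, Real.Gamma_add_one hA, add_comm 1 A,
    show A + 1 + a = A + a + 1 by ring]
  field_simp

theorem connectionConst_add_one_right (A : ℝ) {a : ℝ} (ha : a ≠ 0) :
    connectionConst A a = (A + a) / a * connectionConst A (a + 1) := by
  rw [connectionConst, connectionConst, div_eq_mul_inv, inv_Gamma_eq_self_mul (A + a),
    Real.Gamma_add_one ha, ← add_assoc]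
  field_simp

/-- `F` extends the hypergeometric function with parameters `A, 1 - a; A + 1` to the cut plane and
satisfies the connection formula at `1`. -/
structure IsHypergeometricContinuation (A a : ℝ) (F : ℂ → ℂ) : Prop where
  differentiableOn : DifferentiableOn ℂ F cutPlane
  eq_hypergeometric : ∀ z : ℂ, ‖z‖ < 1 → F z = ₂F₁ (A : ℂ) (1 - (a : ℂ)) ((A : ℂ) + 1) z
  connection : ∀ z : ℂ, ‖1 - z‖ < 1 → z.im ≠ 0 →
    F z = connectionConst A a * z ^ (-(A : ℂ)) -
      (A : ℂ) / a * (1 - z) ^ (a : ℂ) * ₂F₁ 1 ((A : ℂ) + a) ((a : ℂ) + 1) (1 - z)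

theorem continuousAt_eulerIntegral_one {A a : ℝ} (hA : 1 < A) (ha : 1 < a) :
    ContinuousAt (eulerIntegral A a) 1 := by
  refine ContinuousAt.mul continuousAt_const ?_
  refine intervalIntegral.tendsto_integral_filter_of_dominated_convergence
    -- For `|z - 1| < 1` one has `|z| ≤ 2`, hence `|1 - z * u| ≤ 3`.
    (fun _ => 3 ^ (a - 1)) ?_ ?_ intervalIntegrable_const ?_
  · refine Filter.Eventually.of_forall fun z => ?_
    refine Measurable.aestronglyMeasurable ?_
    fun_prop
  · filter_upwards [Metric.ball_mem_nhds (1 : ℂ) one_pos] with z hz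
    refine Filter.Eventually.of_forall fun u hu => ?_
    rw [Set.uIoc_of_le zero_le_one] at hu
    rw [norm_mul, Complex.norm_real, Real.norm_of_nonneg (Real.rpow_nonneg hu.1.le _),
      Complex.norm_cpow_real]
    refine (mul_le_of_le_one_left (by positivity)
      (Real.rpow_le_one hu.1.le hu.2 (by linarith))).trans ?_
    refine Real.rpow_le_rpow (norm_nonneg _) ?_ (by linarith)
    have h1 : ‖z‖ ≤ 2 := by
      rw [mem_ball_iff_norm] at hz
      calc ‖z‖ = ‖(z - 1) + 1‖ := by rw [sub_add_cancel]
        _ ≤ ‖z - 1‖ + ‖(1 : ℂ)‖ := norm_add_le _ _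
        _ ≤ 2 := by rw [norm_one]; linarith
    have h2 : ‖z * u‖ ≤ 2 := by
      rw [norm_mul, Complex.norm_real, Real.norm_of_nonneg hu.1.le]
      nlinarith [norm_nonneg z, hu.2, hu.1]
    calc ‖1 - z * u‖ ≤ ‖(1 : ℂ)‖ + ‖z * u‖ := norm_sub_le _ _
      _ ≤ 3 := by rw [norm_one]; linarith
  · refine Filter.Eventually.of_forall fun u hu => ?_
    rw [Set.uIoc_of_le zero_le_one] at hu
    refine Filter.Tendsto.const_mul _ ?_
    -- The base is `0` at `u = 1`; continuity there uses `a > 1`.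
    have h1 : ContinuousAt (fun x : ℂ => x ^ ((a - 1 : ℝ) : ℂ)) (1 - 1 * u) := by
      refine Complex.continuousAt_cpow_const_of_re_pos (Or.inl ?_) ?_
      · simpa using hu.2
      · rw [Complex.ofReal_re]
        linarith
    have h2 : ContinuousAt (fun z : ℂ => 1 - z * u) 1 := by fun_prop
    exact ContinuousAt.comp (f := fun z : ℂ => 1 - z * u) h1 h2

theorem eulerIntegral_one {A a : ℝ} (hA : 0 < A) (ha : 0 < a) :
    eulerIntegral A a 1 = connectionConst A a := by
  have h : ∫ u in (0 : ℝ)..1, ((u ^ (A - 1) : ℝ) : ℂ) * (1 - 1 * u) ^ ((a - 1 : ℝ) : ℂ) =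
      Complex.betaIntegral A a := by
    refine intervalIntegral.integral_congr fun u hu => ?_
    rw [Set.uIcc_of_le zero_le_one] at hu
    rw [Complex.ofReal_cpow hu.1]
    push_cast
    rw [one_mul]
  rw [eulerIntegral, h, Complex.betaIntegral_eq_Gamma_mul_div _ _ (by simpa) (by simpa),
    connectionConst, add_comm 1 A, Real.Gamma_add_one hA.ne', ← Complex.ofReal_add,
    Complex.Gamma_ofReal, Complex.Gamma_ofReal, Complex.Gamma_ofReal]
  push_cast
  ring

theorem hasDerivAt_one_sub_cpow_mul_hypergeometric (A : ℂ) {a : ℂ} (ha : ∀ n : ℕ, a + n ≠ 0) {z : ℂ}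
    (hz : ‖1 - z‖ < 1) (hz' : z ∈ cutPlane) :
    ∃ D, HasDerivAt (fun z => (1 - z) ^ a * ₂F₁ 1 (A + a) (a + 1) (1 - z)) D z ∧
      z * D + A * ((1 - z) ^ a * ₂F₁ 1 (A + a) (a + 1) (1 - z)) = -a * (1 - z) ^ (a - 1) := by
  obtain ⟨D, hD, hDe⟩ := hasDerivAt_hypergeometric_lower 1 (A + a) ha hz
  have h0 : HasDerivAt (fun z : ℂ => 1 - z) (-1) z := by
    simpa using (hasDerivAt_id z).const_sub 1
  refine ⟨_, (h0.cpow_const hz').mul (hD.comp z h0), ?_⟩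
  have hne : 1 - z ≠ 0 := Complex.slitPlane_ne_zero hz'
  have hpow : (1 - z) ^ a = (1 - z) ^ (a - 1) * (1 - z) := by
    rw [Complex.cpow_sub _ _ hne, Complex.cpow_one, div_mul_cancel₀ _ hne]
  have hc := one_sub_mul_hypergeometric_sub A ha hz
  rw [hpow]
  linear_combination (1 - z) ^ (a - 1) * (-z * hDe - hc)

theorem isHypergeometricContinuation_eulerIntegral {A a : ℝ} (hA : 1 < A) (ha : 1 < a) :
    IsHypergeometricContinuation A a (eulerIntegral A a) where
  differentiableOn := differentiableOn_eulerIntegral hA a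
  eq_hypergeometric z hz := by
    rw [eulerIntegral_eq_hypergeometric hA a hz]
    push_cast
    rfl
  connection z hz him := by
    have hane : ∀ n : ℕ, (a : ℂ) + n ≠ 0 := fun n => by
      norm_cast
      positivity
    have ha0 : (a : ℂ) ≠ 0 := by simpa using hane 0
    set σ : ℝ := z.im with hσ
    -- The half disc at `1` containing `z`: convex, off the branch cuts of `w ^ A` and `(1 - w) ^
    -- a`, and with `1` in its closure.
    set H : Set ℂ := Metric.ball 1 1 ∩ {w : ℂ | 0 < σ * w.im} with hH
    have hHo : IsOpen H :=
      Metric.isOpen_ball.inter (isOpen_lt continuous_const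
        (continuous_const.mul Complex.continuous_im))
    have hHc : Convex ℝ H := by
      refine (convex_ball _ _).inter ?_
      have : {w : ℂ | 0 < σ * w.im} = {w : ℂ | 0 < (σ • Complex.imLm) w} := by
        ext w; simp
      rw [this]
      exact convex_halfSpace_gt (σ • Complex.imLm).isLinear 0
    have hHn : ∀ w ∈ H, ‖1 - w‖ < 1 := fun w hw => by
      rw [norm_sub_rev, ← mem_ball_iff_norm]
      exact hw.1
    have hHi : ∀ w ∈ H, w.im ≠ 0 := fun w hw h => by
      have := hw.2
      simp [h] at this
    have hzH : z ∈ H :=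
      ⟨by rwa [mem_ball_iff_norm, norm_sub_rev], by
        simpa [← hσ] using mul_self_pos.2 him⟩
    -- Two solutions of the same first-order equation are subtracted and multiplied by the
    -- integrating factor `w ^ A`, so `W' = 0`.
    let W : ℂ → ℂ := fun w => (eulerIntegral A a w +
      (A : ℂ) / a * ((1 - w) ^ (a : ℂ) * ₂F₁ 1 ((A : ℂ) + a) ((a : ℂ) + 1) (1 - w))) * w ^ (A : ℂ)
    have hW : ∀ w ∈ H, HasDerivAt W 0 w := by
      intro w hw
      have hcut := mem_cutPlane_of_im_ne_zero (hHi w hw)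
      obtain ⟨D, hD, hDe⟩ := hasDerivAt_eulerIntegral hA a hcut
      obtain ⟨E, hE, hEe⟩ :=
        hasDerivAt_one_sub_cpow_mul_hypergeometric (A : ℂ) hane (hHn w hw) hcut
      have hw0 : w ≠ 0 := fun h => hHi w hw (by simp [h])
      have hp : HasDerivAt (fun w : ℂ => w ^ (A : ℂ)) ((A : ℂ) * w ^ ((A : ℂ) - 1) * 1) w :=
        (hasDerivAt_id w).cpow_const (Complex.mem_slitPlane_iff.2 (Or.inr (hHi w hw)))
      refine ((hD.add (hE.const_mul ((A : ℂ) / a))).mul hp).congr_deriv ?_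
      have hpow : w ^ (A : ℂ) = w ^ ((A : ℂ) - 1) * w := by
        rw [Complex.cpow_sub _ _ hw0, Complex.cpow_one, div_mul_cancel₀ _ hw0]
      rw [hpow]
      push_cast at hDe
      simp only [Pi.add_apply]
      have hEe' := congrArg (fun x => (A : ℂ) / a * x) hEe
      rw [show (A : ℂ) / a * (-a * (1 - w) ^ ((a : ℂ) - 1)) = -A * (1 - w) ^ ((a : ℂ) - 1) by
        field_simp] at hEe'
      linear_combination w ^ ((A : ℂ) - 1) * (hDe + hEe')
    obtain ⟨c, hc⟩ := hHo.exists_is_const_of_deriv_eq_zero (f := W) hHc.isPreconnected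
      (fun w hw => (hW w hw).differentiableAt.differentiableWithinAt) (fun w hw => (hW w hw).deriv)
    have hW1 : ContinuousAt W 1 := by
      have h0 : ContinuousAt (fun w : ℂ => 1 - w) 1 := by fun_prop
      refine ((continuousAt_eulerIntegral_one hA ha).add
        (continuousAt_const.mul (ContinuousAt.mul ?_ ?_))).mul ?_
      · refine ContinuousAt.comp (f := fun w : ℂ => 1 - w) (g := fun x : ℂ => x ^ (a : ℂ))
          (Complex.continuousAt_cpow_const_of_re_pos (Or.inl (by simp)) ?_) h0
        rw [Complex.ofReal_re]
        linarith
      · exact ContinuousAt.comp (f := fun w : ℂ => 1 - w)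
          (continuousAt_hypergeometric 1 ((A : ℂ) + a) ((a : ℂ) + 1) (by simp)) h0
      · exact continuousAt_id.cpow continuousAt_const (by simp)
    have hW1e : W 1 = connectionConst A a := by
      have : (0 : ℂ) ^ (a : ℂ) = 0 := Complex.zero_cpow ha0
      simp [W, eulerIntegral_one (show 0 < A by linarith) (show 0 < a by linarith), this]
    have hcl : (1 : ℂ) ∈ closure H := by
      rw [Metric.mem_closure_iff]
      intro ε hε
      set δ : ℝ := min ε 1 / (2 * |σ|) with hδ
      have hσ0 : 0 < |σ| := abs_pos.2 him
      have hδ0 : 0 < δ := by positivity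
      have hn : ‖((δ * σ : ℝ) : ℂ) * Complex.I‖ = min ε 1 / 2 := by
        rw [norm_mul, Complex.norm_I, mul_one, Complex.norm_real, Real.norm_eq_abs, abs_mul,
          abs_of_pos hδ0, hδ]
        field_simp
      have hm : 0 < min ε 1 := lt_min hε one_pos
      refine ⟨1 + ((δ * σ : ℝ) : ℂ) * Complex.I, ⟨?_, ?_⟩, ?_⟩
      · rw [mem_ball_iff_norm, add_sub_cancel_left, hn]
        linarith [min_le_right ε 1]
      · have : (1 + ((δ * σ : ℝ) : ℂ) * Complex.I).im = δ * σ := by simp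
        rw [Set.mem_ofPred_eq, this]
        have := mul_self_pos.2 him
        nlinarith
      · rw [dist_eq_norm, norm_sub_rev, add_sub_cancel_left, hn]
        linarith [min_le_left ε 1]
    have : (𝓝[H] (1 : ℂ)).NeBot := mem_closure_iff_nhdsWithin_neBot.1 hcl
    -- The constant is the limit of `W` at `1`: the term with `(1 - w) ^ a` dies and Euler's
    -- integral becomes `A * B(A, a)`.
    have hce : c = connectionConst A a := by
      refine tendsto_nhds_unique (f := W) (l := 𝓝[H] (1 : ℂ)) ?_ ?_
      · refine tendsto_const_nhds.congr' ?_
        filter_upwards [self_mem_nhdsWithin] with w hw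
        exact (hc w hw).symm
      · rw [← hW1e]
        exact hW1.tendsto.mono_left nhdsWithin_le_nhds
    have hfin := hc z hzH
    have hz0 : z ≠ 0 := fun h => him (by rw [hσ, h]; exact Complex.zero_im)
    have hzA : z ^ (A : ℂ) ≠ 0 := (Complex.cpow_ne_zero_iff_of_exponent_ne_zero
      (by norm_cast; linarith)).2 hz0
    rw [Complex.cpow_neg, ← hce, ← hfin]
    simp only [W]
    field_simp
    ring

theorem IsHypergeometricContinuation.of_add_one_left {A a : ℝ} (hA : ∀ n : ℕ, A + n ≠ 0) (ha : ∀ n : ℕ, a + n ≠ 0)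
    {F : ℂ → ℂ} (hF : IsHypergeometricContinuation (A + 1) a F) :
    IsHypergeometricContinuation A a
      (fun z => (1 - z) ^ (a : ℂ) + ((A : ℂ) + a) / ((A : ℂ) + 1) * z * F z) := by
  have hA' : ∀ n : ℕ, (A : ℂ) + n ≠ 0 := fun n => by exact_mod_cast hA n
  have ha' : ∀ n : ℕ, (a : ℂ) + n ≠ 0 := fun n => by exact_mod_cast ha n
  have hA1 : (A : ℂ) + 1 ≠ 0 := by simpa using hA' 1
  have ha0 : (a : ℂ) ≠ 0 := by simpa using ha' 0
  refine ⟨?_, fun z hz => ?_, fun z hz him => ?_⟩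
  · refine DifferentiableOn.add ?_ ?_
    · exact ((differentiableOn_const 1).sub differentiableOn_id).cpow
        (differentiableOn_const _) (fun z hz => hz)
    · exact (((differentiableOn_const _).mul differentiableOn_id)).mul hF.differentiableOn
  · rw [hypergeometric_eq_one_sub_cpow_add hA' hz, hF.eq_hypergeometric z hz]
    push_cast
    rfl
  · have hz0 : z ≠ 0 := fun h => him (by simp [h])
    have hc := add_mul_hypergeometric_eq (A : ℂ) ha' hz
    have hpow : z ^ (-(A : ℂ)) = z * z ^ (-((A : ℂ) + 1)) := by
      rw [neg_add, ← sub_eq_add_neg, Complex.cpow_sub _ _ hz0, Complex.cpow_one]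
      field_simp
    rw [hF.connection z hz him, connectionConst_add_one_left (A := A) (by exact_mod_cast hA1) a]
    push_cast
    rw [hpow]
    rw [sub_sub_cancel] at hc
    field_simp
    linear_combination (1 - z) ^ (a : ℂ) * (A + 1) * hc

theorem IsHypergeometricContinuation.of_add_one_right {A a : ℝ} (hA : ∀ n : ℕ, A + n ≠ 0)
    (ha : ∀ n : ℕ, a + n ≠ 0) {F : ℂ → ℂ} (hF : IsHypergeometricContinuation A (a + 1) F) :
    IsHypergeometricContinuation A a
      (fun z => -((A : ℂ) / a) * (1 - z) ^ (a : ℂ) + ((A : ℂ) + a) / a * F z) := by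
  have hA' : ∀ n : ℕ, (A : ℂ) + n ≠ 0 := fun n => by exact_mod_cast hA n
  have ha' : ∀ n : ℕ, (a : ℂ) + n ≠ 0 := fun n => by exact_mod_cast ha n
  have ha1 : ∀ n : ℕ, (a : ℂ) + 1 + n ≠ 0 := fun n => by
    have := ha' (n + 1)
    push_cast at this
    rwa [add_assoc, add_comm (1 : ℂ)]
  have ha0 : (a : ℂ) ≠ 0 := by simpa using ha' 0
  refine ⟨?_, fun z hz => ?_, fun z hz him => ?_⟩
  · refine DifferentiableOn.add ?_ ((differentiableOn_const _).mul hF.differentiableOn)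
    exact (differentiableOn_const _).mul (((differentiableOn_const 1).sub differentiableOn_id).cpow
        (differentiableOn_const _) (fun z hz => hz))
  · rw [hypergeometric_eq_neg_one_sub_cpow_add hA' ha0 hz, hF.eq_hypergeometric z hz]
    push_cast
    rfl
  · have hne : 1 - z ≠ 0 := fun h => him (by rw [← sub_eq_zero.1 h]; simp)
    have hc := hypergeometric_eq_one_add ((A : ℂ) + a) ha1 hz
    have hpow : (1 - z) ^ ((a : ℂ) + 1) = (1 - z) ^ (a : ℂ) * (1 - z) := by
      rw [Complex.cpow_add _ _ hne, Complex.cpow_one]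
    have h1 : (a : ℂ) + 1 ≠ 0 := by simpa using ha1 0
    rw [hF.connection z hz him, connectionConst_add_one_right A (a := a) (by exact_mod_cast ha0), hc]
    push_cast
    rw [hpow, ← add_assoc]
    field_simp
    ring

theorem exists_isHypergeometricContinuation {A a : ℝ} (hA : ∀ n : ℕ, A + n ≠ 0) (ha : ∀ n : ℕ, a + n ≠ 0) :
    ∃ F, IsHypergeometricContinuation A a F := by
  have key : ∀ (N : ℕ) (A a : ℝ), (∀ n : ℕ, A + n ≠ 0) → (∀ n : ℕ, a + n ≠ 0) → 1 < A + N →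
      1 < a + N → ∃ F, IsHypergeometricContinuation A a F := by
    intro N
    induction N with
    | zero =>
      intro A a _ _ h1 h2
      exact ⟨_, isHypergeometricContinuation_eulerIntegral (by simpa using h1) (by simpa using h2)⟩
    | succ N ih =>
      intro A a hA ha h1 h2
      have shift : ∀ {x : ℝ}, (∀ n : ℕ, x + n ≠ 0) → ∀ n : ℕ, x + 1 + n ≠ 0 := fun {x} h n => by
        have := h (n + 1)
        push_cast at this
        rwa [add_assoc, add_comm (1 : ℝ)]
      push_cast at h1 h2
      obtain ⟨F, hF⟩ := ih (A + 1) (a + 1) (shift hA) (shift ha) (by linarith) (by linarith)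
      -- From `(A + 1, a + 1)` to `(A, a + 1)` to `(A, a)`.
      exact ⟨_, (hF.of_add_one_left hA (shift ha)).of_add_one_right hA ha⟩
  obtain ⟨N, hN⟩ := exists_nat_gt (max (1 - A) (1 - a))
  exact key N A a hA ha (by linarith [le_max_left (1 - A) (1 - a)])
    (by linarith [le_max_right (1 - A) (1 - a)])

end ConnectionFormula

/-! ### Boundary values on the real axis and cancellation of phases -/

section SideValue

theorem negOnePow_mul_neg (σ γ : ℝ) : negOnePow σ γ * negOnePow (-σ) γ = 1 := by
  rw [negOnePow, negOnePow, ← Complex.exp_add, ← Complex.exp_zero]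
  congr 1
  push_cast
  ring

theorem neg_cpow_of_side {σ : ℝ} (hσ : σ = 1 ∨ σ = -1) {w : ℂ} (hw : 0 < σ * w.im) (γ : ℝ) :
    (-w) ^ (γ : ℂ) = negOnePow (-σ) γ * w ^ (γ : ℂ) := by
  have hw0 : w ≠ 0 := by
    rintro rfl
    simp at hw
  have harg : Complex.arg (-w) = Complex.arg w - σ * Real.pi := by
    rcases hσ with rfl | rfl
    · rw [Complex.arg_neg_eq_arg_sub_pi_of_im_pos (by simpa using hw)]
      ring
    · rw [Complex.arg_neg_eq_arg_add_pi_of_im_neg (by simpa using hw)]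
      ring
  rw [Complex.cpow_def_of_ne_zero hw0, Complex.cpow_def_of_ne_zero (neg_ne_zero.2 hw0), negOnePow,
    ← Complex.exp_add, Complex.log, Complex.log, norm_neg, harg]
  congr 1
  push_cast
  ring

/-- The limit of `(1 - w) ^ γ` as `w → x` with `0 < σ * w.im`. -/
noncomputable def oneSubSideLimit (σ γ x : ℝ) : ℂ :=
  (if 1 < x then negOnePow (-σ) γ else 1) * ((|1 - x| ^ γ : ℝ) : ℂ)

/-- Beyond `1` the power is rewritten through `w - 1`, which is continuous there, at the cost of a
phase depending on the side. At `x = 1` itself `0 < γ` is needed; this is the case `t = a` of the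
integral. -/
theorem tendsto_one_sub_cpow_side {σ : ℝ} (hσ : σ = 1 ∨ σ = -1) {γ x : ℝ} (hx : x ≠ 1 ∨ 0 < γ) :
    Filter.Tendsto (fun w : ℂ => (1 - w) ^ (γ : ℂ)) (𝓝[{w : ℂ | 0 < σ * w.im}] (x : ℂ))
      (𝓝 (oneSubSideLimit σ γ x)) := by
  have h0 : ContinuousAt (fun w : ℂ => 1 - w) (x : ℂ) := by fun_prop
  rw [oneSubSideLimit]
  by_cases h1 : 1 < x
  · rw [if_pos h1]
    have hc : ContinuousAt (fun w : ℂ => negOnePow (-σ) γ * (w - 1) ^ (γ : ℂ)) (x : ℂ) := by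
      refine continuousAt_const.mul (ContinuousAt.cpow (by fun_prop) continuousAt_const ?_)
      norm_cast
      exact Complex.ofReal_mem_slitPlane.2 (sub_pos.2 h1)
    have hv : ((|1 - x| ^ γ : ℝ) : ℂ) = ((x : ℂ) - 1) ^ (γ : ℂ) := by
      rw [abs_sub_comm, abs_of_pos (sub_pos.2 h1), Complex.ofReal_cpow (sub_pos.2 h1).le]
      push_cast
      rfl
    rw [hv]
    refine (hc.tendsto.mono_left nhdsWithin_le_nhds).congr' ?_
    filter_upwards [self_mem_nhdsWithin] with w hw
    rw [← neg_cpow_of_side hσ (by simpa using hw), neg_sub]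
  · rw [if_neg h1, one_mul]
    push Not at h1
    have hv : ((|1 - x| ^ γ : ℝ) : ℂ) = (1 - (x : ℂ)) ^ (γ : ℂ) := by
      rw [abs_of_nonneg (sub_nonneg.2 h1), Complex.ofReal_cpow (sub_nonneg.2 h1)]
      push_cast
      rfl
    rw [hv]
    refine Filter.Tendsto.mono_left ?_ nhdsWithin_le_nhds
    refine ContinuousAt.comp (f := fun w : ℂ => 1 - w) (g := fun w : ℂ => w ^ (γ : ℂ)) ?_ h0
    rcases hx with hx | hx
    · refine continuousAt_id.cpow continuousAt_const ?_
      have : (1 - (x : ℂ)) = ((1 - x : ℝ) : ℂ) := by push_cast; rfl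
      rw [id, this]
      exact Complex.ofReal_mem_slitPlane.2 (sub_pos.2 (h1.lt_of_ne hx))
    · refine Complex.continuousAt_cpow_const_of_re_pos (Or.inl ?_) (by simpa using hx)
      simpa using h1

theorem IsHypergeometricContinuation.isSideValue {A a : ℝ} {F : ℂ → ℂ} (hF : IsHypergeometricContinuation A a F) {σ : ℝ}
    (hσ : σ = 1 ∨ σ = -1) {x : ℝ} (hx0 : 0 < x) (hx2 : |1 - x| < 1) (hx : x ≠ 1 ∨ 0 < a) :
    IsSideValue F σ x (connectionConst A a * ((x ^ (-A) : ℝ) : ℂ) -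
      (A : ℂ) / a * oneSubSideLimit σ a x * ((₂F₁ 1 (A + a) (a + 1) (1 - x) : ℝ) : ℂ)) := by
  have hn : ‖1 - (x : ℂ)‖ < 1 := by
    rw [← Complex.ofReal_one, ← Complex.ofReal_sub, Complex.norm_real]
    exact hx2
  have h0 : ContinuousAt (fun w : ℂ => 1 - w) (x : ℂ) := by fun_prop
  have hG : ((₂F₁ 1 (A + a) (a + 1) (1 - x) : ℝ) : ℂ) =
      ₂F₁ 1 ((A : ℂ) + a) ((a : ℂ) + 1) (1 - (x : ℂ)) := by
    rw [hypergeometric_ofReal]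
    push_cast
    rfl
  rw [hG, Complex.ofReal_cpow hx0.le, Complex.ofReal_neg]
  have h1 : ContinuousAt (fun w : ℂ => (connectionConst A a : ℂ) * w ^ (-(A : ℂ))) (x : ℂ) :=
    continuousAt_const.mul (continuousAt_id.cpow continuousAt_const
      (Complex.ofReal_mem_slitPlane.2 hx0))
  have h2 : ContinuousAt (fun w : ℂ => ₂F₁ 1 ((A : ℂ) + a) ((a : ℂ) + 1) (1 - w)) (x : ℂ) :=
    ContinuousAt.comp (f := fun w : ℂ => 1 - w)
      (continuousAt_hypergeometric 1 ((A : ℂ) + a) ((a : ℂ) + 1) hn) h0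
  have hlim := (h1.tendsto.mono_left
    (nhdsWithin_le_nhds (s := {w : ℂ | 0 < σ * w.im}))).sub
    (((tendsto_one_sub_cpow_side hσ hx).const_mul ((A : ℂ) / a)).mul
      (h2.tendsto.mono_left nhdsWithin_le_nhds))
  refine hlim.congr' ?_
  have hev : ∀ᶠ w in 𝓝[{w : ℂ | 0 < σ * w.im}] (x : ℂ), ‖1 - w‖ < 1 :=
    nhdsWithin_le_nhds (h0.norm.eventually_lt_const hn)
  filter_upwards [hev, self_mem_nhdsWithin] with w hw1 hw2
  refine (hF.connection w hw1 fun him => ?_).symm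
  have : 0 < σ * w.im := hw2
  simp [him] at this

theorem sidePow_mul_of_pos (σ x : ℝ) {w : ℝ} (hw : 0 < w) (γ β : ℝ) :
    sidePow σ (x * w) γ β = sidePow σ x γ β * ((w ^ (γ + β) : ℝ) : ℂ) := by
  have h1 : |x * w| ^ γ = |x| ^ γ * w ^ γ := by
    rw [abs_mul, abs_of_pos hw, Real.mul_rpow (abs_nonneg x) hw.le]
  have h2 : x * w < 0 ↔ x < 0 := by
    constructor
    · intro h
      by_contra hx
      exact absurd h (mul_nonneg (not_lt.1 hx) hw.le).not_gt
    · exact fun h => mul_neg_of_neg_of_pos h hw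
  rw [sidePow, sidePow, h1, realPow_mul_of_pos x hw, Real.rpow_add hw]
  simp only [h2]
  push_cast
  ring

theorem sidePow_of_pos (σ : ℝ) {x : ℝ} (hx : 0 < x) (γ β : ℝ) :
    sidePow σ x γ β = ((x ^ (γ + β) : ℝ) : ℂ) := by
  rw [sidePow, if_neg hx.not_gt, realPow_of_pos hx, abs_of_pos hx, Real.rpow_add hx]
  push_cast
  ring

/-- For `s > 0` exactly one phase opposes `negOnePow σ a`: if `b > 0` then `1 + s / b > 1` and it
comes from the side limit, if `b < 0` it comes from `sidePow`. So the result is real for either `σ`.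
-/
theorem negOnePow_mul_sidePow_mul_oneSubSideLimit (σ : ℝ) {a b s : ℝ} (β : ℝ) (hb : b ≠ 0)
    (hs0 : 0 ≤ s) (hsa : 0 < s ∨ 0 < a) :
    negOnePow σ a * sidePow σ b a β * oneSubSideLimit σ a (1 + s / b) =
      ((realPow b β * s ^ a : ℝ) : ℂ) := by
  have hsb : |1 - (1 + s / b)| = s / |b| := by
    rw [sub_add_cancel_left, abs_neg, abs_div, abs_of_nonneg hs0]
  have hb' : 0 < |b| := abs_pos.2 hb
  have hpow : s ^ a = |b| ^ a * (s / |b|) ^ a := by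
    rw [← Real.mul_rpow hb'.le (by positivity)]
    congr 1
    field_simp
  rw [sidePow, oneSubSideLimit, hsb, hpow]
  rcases hs0.eq_or_lt with rfl | hs
  · have ha : a ≠ 0 := (hsa.resolve_left (lt_irrefl _)).ne'
    simp [Real.zero_rpow ha]
  have h1 := negOnePow_mul_neg σ a
  rcases hb.lt_or_gt with hneg | hpos
  · have : ¬ 1 < 1 + s / b := by
      have := div_neg_of_pos_of_neg hs hneg
      linarith
    rw [if_pos hneg, if_neg this]
    push_cast
    linear_combination (((|b| ^ a : ℝ) : ℂ) * ((realPow b β : ℝ) : ℂ) * (((s / |b|) ^ a : ℝ) : ℂ)) * h1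
  · have : 1 < 1 + s / b := by
      have := div_pos hs hpos
      linarith
    rw [if_neg hpos.not_gt, if_pos this]
    push_cast
    linear_combination (((|b| ^ a : ℝ) : ℂ) * ((realPow b β : ℝ) : ℂ) * (((s / |b|) ^ a : ℝ) : ℂ)) * h1

/-- The power term plus hypergeometric term form of `C s ^ a / Γ(a + 1) ₂F₁ 1 (-β) (a + 1) (-s / b)`,
with `C` the real power `b ^ β`. -/
theorem IsHypergeometricContinuation.exists_isSideValue {A a β : ℝ} (hAa : A + a = -β)
    (hA : ∀ m : ℤ, A ≠ m) (ha : ∀ n : ℕ, a + n ≠ 0) {F : ℂ → ℂ} (hF : IsHypergeometricContinuation A a F)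
    {σ : ℝ} (hσ : σ = 1 ∨ σ = -1) {b s : ℝ} (hs0 : 0 ≤ s) (hsa : 0 < s ∨ 0 < a) (hs : s < |b|) :
    ∃ v : ℂ, IsSideValue F σ ((b + s) / b) v ∧
      ((realPow b β * (s ^ a / Real.Gamma (a + 1) * ₂F₁ 1 (-β) (a + 1) (-(s / b))) : ℝ) : ℂ) =
        negOnePow σ a * (Real.Gamma A : ℂ) / (Real.Gamma (-β) : ℂ) * sidePow σ (b + s) a β +
        negOnePow σ a * (Real.Gamma (-A) : ℂ) * sidePow σ b a β /
          ((Real.Gamma a : ℂ) * (Real.Gamma (-A + 1) : ℂ)) * v := by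
  have hb : b ≠ 0 := abs_pos.1 (hs0.trans_lt hs)
  have hA0 : A ≠ 0 := by simpa using hA 0
  have ha0 : a ≠ 0 := by simpa using ha 0
  have hx : (b + s) / b = 1 + s / b := by field_simp
  have hx0 : 0 < 1 + s / b := one_add_div_pos hs0 le_rfl hs
  have hx2 : |1 - (1 + s / b)| < 1 := by
    rw [sub_add_cancel_left, abs_neg, abs_div, abs_of_nonneg hs0, div_lt_one (abs_pos.2 hb)]
    exact hs
  have hx1 : 1 + s / b ≠ 1 ∨ 0 < a := by
    refine hsa.imp_left fun h => ?_
    simp [h.ne', hb]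
  have hbs : b + s = b * (1 + s / b) := by field_simp
  have hexp : a + β = -A := by linarith
  rw [hx]
  refine ⟨_, hF.isSideValue hσ hx0 hx2 hx1, ?_⟩
  have hL := negOnePow_mul_sidePow_mul_oneSubSideLimit σ β hb hs0 hsa
  -- The `x ^ (-A)` part of `v` cancels the explicit power term, since `Γ(-A + 1) = -A * Γ(-A)`;
  -- what remains is reduced by `hL`.
  rw [hbs, sidePow_mul_of_pos σ b hx0, hexp, sub_add_cancel_left, hAa, connectionConst, hAa,
    add_comm 1 A, Real.Gamma_add_one hA0, Real.Gamma_add_one (neg_ne_zero.2 hA0),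
    Real.Gamma_add_one ha0]
  have g1 : (Real.Gamma a : ℂ) ≠ 0 := by
    norm_cast
    exact Real.Gamma_ne_zero fun m h => ha m (by rw [h]; ring)
  have g2 : (Real.Gamma (-A) : ℂ) ≠ 0 := by
    norm_cast
    exact Real.Gamma_ne_zero fun m h => hA m (by exact_mod_cast neg_inj.1 h)
  have hA0' : (A : ℂ) ≠ 0 := by exact_mod_cast hA0
  have ha0' : (a : ℂ) ≠ 0 := by exact_mod_cast ha0
  generalize oneSubSideLimit σ a (1 + s / b) = L at hL ⊢
  generalize (₂F₁ 1 (-β) (a + 1) (-(s / b)) : ℝ) = G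
  push_cast at hL ⊢
  field_simp
  linear_combination -G * hL

end SideValue

/-! ### Assembly of the main theorem -/

theorem IsHypergeometricContinuation.isPrincipalBranch {A a : ℝ} {F : ℂ → ℂ} (hF : IsHypergeometricContinuation A a F) :
    IsPrincipalBranch (A : ℂ) ((1 - a : ℝ) : ℂ) ((A + 1 : ℝ) : ℂ) F := by
  refine ⟨hF.differentiableOn, fun z hz => ?_⟩
  rw [hF.eq_hypergeometric z hz]
  push_cast
  rfl

theorem mainTheorem3 (α β d : ℝ) (hα₀ : 0 < α) (hα₁ : α < 1) :
    -- fractional integral, lower limit `d⁺ = d + ε`: series and hypergeometric form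
    (∀ ε : ℝ, 0 < ε → ∀ t ∈ Set.Ico (d + ε) (d + ε + ε),
      IntervalIntegrable (rlKernel α (powerFun d β) t) MeasureTheory.volume (d + ε) t ∧
      HasSum (fun k : ℕ => gammaRatio β k * ε ^ (β - k) * (t - (d + ε)) ^ (α + k) /
          Real.Gamma (α + k + 1))
        (rlIntegral α (d + ε) (powerFun d β) t) ∧
      rlIntegral α (d + ε) (powerFun d β) t =
        ε ^ (α + β) * ((t - d) / ε - 1) ^ α / Real.Gamma (α + 1) *
          ₂F₁ 1 (-β) (α + 1) (1 - (t - d) / ε)) ∧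
    -- fractional integral, lower limit `a`: series and hypergeometric form
    (∀ a t : ℝ, t ∈ Set.Ico a (a + |d - a| / 2) → Set.Icc a t ⊆ powerDomain d β →
      IntervalIntegrable (rlKernel α (powerFun d β) t) MeasureTheory.volume a t ∧
      HasSum (fun k : ℕ => gammaRatio β k * realPow (a - d) (β - k) * (t - a) ^ (α + k) /
          Real.Gamma (α + k + 1))
        (rlIntegral α a (powerFun d β) t) ∧
      rlIntegral α a (powerFun d β) t =
        realPow (a - d) β * (t - a) ^ α / Real.Gamma (α + 1) *
          ₂F₁ 1 (-β) (α + 1) (1 - (t - d) / (a - d))) ∧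
    -- fractional derivative, lower limit `d⁺ = d + ε`: series and hypergeometric form
    (∀ ε : ℝ, 0 < ε → ∀ t ∈ Set.Ioo (d + ε) (d + ε + ε),
      DifferentiableAt ℝ (rlIntegral (1 - α) (d + ε) (powerFun d β)) t ∧
      HasSum (fun k : ℕ => gammaRatio β k * ε ^ (β - k) * (t - (d + ε)) ^ (-α + k) /
          Real.Gamma (-α + k + 1))
        (rlDeriv α (d + ε) (powerFun d β) t) ∧
      rlDeriv α (d + ε) (powerFun d β) t =
        ε ^ (-α + β) * ((t - d) / ε - 1) ^ (-α) / Real.Gamma (-α + 1) *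
          ₂F₁ 1 (-β) (-α + 1) (1 - (t - d) / ε)) ∧
    -- fractional derivative, lower limit `a`: series and hypergeometric form
    (∀ a t : ℝ, t ∈ Set.Ioo a (a + |d - a| / 2) → Set.Icc a t ⊆ powerDomain d β →
      DifferentiableAt ℝ (rlIntegral (1 - α) a (powerFun d β)) t ∧
      HasSum (fun k : ℕ => gammaRatio β k * realPow (a - d) (β - k) * (t - a) ^ (-α + k) /
          Real.Gamma (-α + k + 1))
        (rlDeriv α a (powerFun d β) t) ∧
      rlDeriv α a (powerFun d β) t =
        realPow (a - d) β * (t - a) ^ (-α) / Real.Gamma (-α + 1) *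
          ₂F₁ 1 (-β) (-α + 1) (1 - (t - d) / (a - d))) ∧
    -- fractional integrals: power term plus hypergeometric term
    ((∀ m : ℤ, α + β ≠ m) →
      ∃ F : ℂ → ℂ,
        IsPrincipalBranch ((-α - β : ℝ) : ℂ) ((1 - α : ℝ) : ℂ) ((1 - α - β : ℝ) : ℂ) F ∧
        ∀ σ : ℝ, (σ = 1 ∨ σ = -1) →
          (∀ ε : ℝ, 0 < ε → ∀ t ∈ Set.Ico (d + ε) (d + ε + ε),
            ∃ v : ℂ, IsSideValue F σ ((t - d) / ε) v ∧
              (rlIntegral α (d + ε) (powerFun d β) t : ℂ) =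
                negOnePow σ α * (Real.Gamma (-α - β) : ℂ) / (Real.Gamma (-β) : ℂ) *
                    (((t - d) ^ (α + β) : ℝ) : ℂ) +
                  negOnePow σ α * (Real.Gamma (α + β) : ℂ) * ((ε ^ (α + β) : ℝ) : ℂ) /
                    ((Real.Gamma α : ℂ) * (Real.Gamma (α + β + 1) : ℂ)) * v) ∧
          (∀ a t : ℝ, t ∈ Set.Ico a (a + |d - a| / 2) → Set.Icc a t ⊆ powerDomain d β →
            ∃ v : ℂ, IsSideValue F σ ((t - d) / (a - d)) v ∧
              (rlIntegral α a (powerFun d β) t : ℂ) =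
                negOnePow σ α * (Real.Gamma (-α - β) : ℂ) / (Real.Gamma (-β) : ℂ) *
                    sidePow σ (t - d) α β +
                  negOnePow σ α * (Real.Gamma (α + β) : ℂ) * sidePow σ (a - d) α β /
                    ((Real.Gamma α : ℂ) * (Real.Gamma (α + β + 1) : ℂ)) * v)) ∧
    -- fractional derivatives: power term plus hypergeometric term
    ((∀ m : ℤ, -α + β ≠ m) →
      ∃ F : ℂ → ℂ,
        IsPrincipalBranch ((α - β : ℝ) : ℂ) ((1 + α : ℝ) : ℂ) ((1 + α - β : ℝ) : ℂ) F ∧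
        ∀ σ : ℝ, (σ = 1 ∨ σ = -1) →
          (∀ ε : ℝ, 0 < ε → ∀ t ∈ Set.Ioo (d + ε) (d + ε + ε),
            ∃ v : ℂ, IsSideValue F σ ((t - d) / ε) v ∧
              (rlDeriv α (d + ε) (powerFun d β) t : ℂ) =
                negOnePow σ (-α) * (Real.Gamma (α - β) : ℂ) / (Real.Gamma (-β) : ℂ) *
                    (((t - d) ^ (-α + β) : ℝ) : ℂ) +
                  negOnePow σ (-α) * (Real.Gamma (-α + β) : ℂ) * ((ε ^ (-α + β) : ℝ) : ℂ) /
                    ((Real.Gamma (-α) : ℂ) * (Real.Gamma (-α + β + 1) : ℂ)) * v) ∧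
          (∀ a t : ℝ, t ∈ Set.Ioo a (a + |d - a| / 2) → Set.Icc a t ⊆ powerDomain d β →
            ∃ v : ℂ, IsSideValue F σ ((t - d) / (a - d)) v ∧
              (rlDeriv α a (powerFun d β) t : ℂ) =
                negOnePow σ (-α) * (Real.Gamma (α - β) : ℂ) / (Real.Gamma (-β) : ℂ) *
                    sidePow σ (t - d) (-α) β +
                  negOnePow σ (-α) * (Real.Gamma (-α + β) : ℂ) * sidePow σ (a - d) (-α) β /
                    ((Real.Gamma (-α) : ℂ) * (Real.Gamma (-α + β + 1) : ℂ)) * v)) := by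
  have bnd : ∀ {a t : ℝ}, t < a + |d - a| / 2 → t - a < |a - d| := fun {a t} h => by
    rw [abs_sub_comm]
    linarith [abs_nonneg (d - a)]
  have bndε : ∀ {ε t : ℝ}, 0 < ε → t < d + ε + ε → t - (d + ε) < |d + ε - d| := fun {ε t} h h' => by
    rw [add_sub_cancel_left, abs_of_pos h]
    linarith
  have hz : ∀ {b s : ℝ}, b ≠ 0 → 1 - (b + s) / b = -(s / b) := fun {b s} hb => by
    field_simp
    ring
  have hzε : ∀ {ε t : ℝ}, t - d = ε + (t - (d + ε)) := fun {ε t} => by ring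
  have hza : ∀ {a t : ℝ}, t - d = (a - d) + (t - a) := fun {a t} => by ring
  -- If `a = d` the interval for `t` is empty.
  have hane : ∀ {a t : ℝ}, a ≤ t → t < a + |d - a| / 2 → a ≠ d := by
    rintro a t h1 h2 rfl
    simp at h2
    linarith
  have series : ∀ {γ : ℝ}, 0 < γ + 1 → ∀ {ε s : ℝ}, 0 < ε → 0 ≤ s → (0 < s ∨ 0 < γ) → s < ε →
      HasSum (fun k : ℕ => gammaRatio β k * ε ^ (β - k) * s ^ (γ + k) / Real.Gamma (γ + k + 1))
        (realPow ε β * (s ^ γ / Real.Gamma (γ + 1) * ₂F₁ 1 (-β) (γ + 1) (-(s / ε)))) := by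
    intro γ hγ ε s hε hs0 hs hsε
    refine (hasSum_gammaRatio hγ β (realPow ε β) hs0 hs (by rwa [abs_of_pos hε])).congr_fun
      fun k => ?_
    rw [realPow_of_pos hε, Real.rpow_sub_natCast hε.ne']
  have seriesa : ∀ {γ : ℝ}, 0 < γ + 1 → ∀ {a t : ℝ}, a ≠ d → a ∈ powerDomain d β → a ≤ t →
      (0 < t - a ∨ 0 < γ) → t - a < |a - d| →
      HasSum (fun k : ℕ => gammaRatio β k * realPow (a - d) (β - k) * (t - a) ^ (γ + k) /
          Real.Gamma (γ + k + 1))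
        (realPow (a - d) β *
          ((t - a) ^ γ / Real.Gamma (γ + 1) * ₂F₁ 1 (-β) (γ + 1) (-((t - a) / (a - d))))) := by
    intro γ hγ a t hd ha hat hs hb
    refine (hasSum_gammaRatio hγ β (realPow (a - d) β) (sub_nonneg.2 hat) hs hb).congr_fun
      fun k => ?_
    -- `powerDomain` enters only here: for `a < d`, splitting off `(a - d) ^ k` needs an exponent
    -- with odd denominator.
    rw [realPow_sub_natCast (sub_ne_zero.2 hd) (odd_den_of_mem_powerDomain hd ha)]
  have closedε : ∀ {γ ε t : ℝ}, 0 < ε → d + ε ≤ t →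
      realPow ε β * ((t - (d + ε)) ^ γ / Real.Gamma (γ + 1) *
        ₂F₁ 1 (-β) (γ + 1) (-((t - (d + ε)) / ε))) =
      ε ^ (γ + β) * ((t - d) / ε - 1) ^ γ / Real.Gamma (γ + 1) *
          ₂F₁ 1 (-β) (γ + 1) (1 - (t - d) / ε) := by
    intro γ ε t hε ht
    rw [hzε (ε := ε) (t := t), hz hε.ne', realPow_of_pos hε,
      show (ε + (t - (d + ε))) / ε - 1 = (t - (d + ε)) / ε by field_simp; ring,
      Real.div_rpow (sub_nonneg.2 ht) hε.le, Real.rpow_add hε]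
    have := (Real.rpow_pos_of_pos hε γ).ne'
    field_simp
  have closeda : ∀ {γ a t : ℝ}, a ≠ d →
      realPow (a - d) β * ((t - a) ^ γ / Real.Gamma (γ + 1) *
        ₂F₁ 1 (-β) (γ + 1) (-((t - a) / (a - d)))) =
      realPow (a - d) β * (t - a) ^ γ / Real.Gamma (γ + 1) *
          ₂F₁ 1 (-β) (γ + 1) (1 - (t - d) / (a - d)) := by
    intro γ a t hd
    rw [hza (a := a) (t := t), hz (sub_ne_zero.2 hd)]
    ring
  refine ⟨?_, ?_, ?_, ?_, ?_, ?_⟩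
  · intro ε hε t ht
    have hb := bndε hε ht.2
    have hval := rlIntegral_powerFun hα₀ β d ht.1 hb
    have hi := intervalIntegrable_rlKernel_powerFun hα₀ β d ht.1 hb
    rw [add_sub_cancel_left] at hval
    rw [hval]
    exact ⟨hi, series (by linarith) hε (sub_nonneg.2 ht.1) (Or.inr hα₀) (by linarith [ht.2]),
      closedε hε ht.1⟩
  · intro a t ht hdom
    have hd := hane ht.1 ht.2
    rw [rlIntegral_powerFun hα₀ β d ht.1 (bnd ht.2)]
    exact ⟨intervalIntegrable_rlKernel_powerFun hα₀ β d ht.1 (bnd ht.2),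
      seriesa (by linarith) hd (hdom ⟨le_rfl, ht.1⟩) ht.1 (Or.inr hα₀) (bnd ht.2), closeda hd⟩
  · intro ε hε t ht
    have hb := bndε hε ht.2
    have hval := rlDeriv_powerFun hα₁ β d ht.1 hb
    have hi := (hasDerivAt_rlIntegral_powerFun hα₁ β d ht.1 hb).differentiableAt
    rw [add_sub_cancel_left] at hval
    rw [hval]
    exact ⟨hi, series (by linarith) hε (sub_nonneg.2 ht.1.le) (Or.inl (sub_pos.2 ht.1))
      (by linarith [ht.2]), closedε hε ht.1.le⟩
  · intro a t ht hdom
    have hd := hane ht.1.le ht.2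
    rw [rlDeriv_powerFun hα₁ β d ht.1 (bnd ht.2)]
    exact ⟨(hasDerivAt_rlIntegral_powerFun hα₁ β d ht.1 (bnd ht.2)).differentiableAt,
      seriesa (by linarith) hd (hdom ⟨le_rfl, ht.1.le⟩) ht.1.le (Or.inl (sub_pos.2 ht.1))
      (bnd ht.2), closeda hd⟩
  · intro hαβ
    have hA : ∀ m : ℤ, -α - β ≠ m := fun m h => hαβ (-m) (by push_cast; linarith)
    have ha : ∀ n : ℕ, α + n ≠ 0 := fun n => by positivity
    obtain ⟨F, hF⟩ := exists_isHypergeometricContinuation (A := -α - β) (a := α)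
      (fun n h => hA (-n) (by push_cast; linarith)) ha
    refine ⟨F, ?_, fun σ hσ => ⟨fun ε hε t ht => ?_, fun a t ht hdom => ?_⟩⟩
    · have := hF.isPrincipalBranch
      rwa [show -α - β + 1 = 1 - α - β by ring] at this
    · obtain ⟨v, hv, he⟩ := hF.exists_isSideValue (β := β) (by ring) hA ha hσ (b := ε)
        (sub_nonneg.2 ht.1) (Or.inr hα₀) (by rw [abs_of_pos hε]; linarith [ht.2])
      have hval := rlIntegral_powerFun hα₀ β d ht.1 (bndε hε ht.2)
      rw [add_sub_cancel_left] at hval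
      rw [← hzε] at hv he
      refine ⟨v, hv, ?_⟩
      rw [hval, he, sidePow_of_pos σ hε, sidePow_of_pos σ (by linarith [ht.1]),
        show -(-α - β) = α + β by ring]
    · obtain ⟨v, hv, he⟩ := hF.exists_isSideValue (β := β) (by ring) hA ha hσ (b := a - d)
        (sub_nonneg.2 ht.1) (Or.inr hα₀) (bnd ht.2)
      rw [← hza] at hv he
      refine ⟨v, hv, ?_⟩
      rw [rlIntegral_powerFun hα₀ β d ht.1 (bnd ht.2), he, show -(-α - β) = α + β by ring]
  · intro hαβ
    have hA : ∀ m : ℤ, α - β ≠ m := fun m h => hαβ (-m) (by push_cast; linarith)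
    -- `-α` lies strictly between `-1` and `0`, so no shift of it by a natural number vanishes.
    have ha : ∀ n : ℕ, -α + n ≠ 0 := fun n h => by
      rcases n with _ | n
      · simp at h
        linarith
      · have : (0 : ℝ) ≤ n := n.cast_nonneg
        push_cast at h
        linarith
    obtain ⟨F, hF⟩ := exists_isHypergeometricContinuation (A := α - β) (a := -α)
      (fun n h => hA (-n) (by push_cast; linarith)) ha
    refine ⟨F, ?_, fun σ hσ => ⟨fun ε hε t ht => ?_, fun a t ht hdom => ?_⟩⟩
    · have := hF.isPrincipalBranch
      rwa [show α - β + 1 = 1 + α - β by ring, show 1 - -α = 1 + α by ring] at this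
    · obtain ⟨v, hv, he⟩ := hF.exists_isSideValue (β := β) (by ring) hA ha hσ (b := ε)
        (sub_nonneg.2 ht.1.le) (Or.inl (sub_pos.2 ht.1)) (by rw [abs_of_pos hε]; linarith [ht.2])
      have hval := rlDeriv_powerFun hα₁ β d ht.1 (bndε hε ht.2)
      rw [add_sub_cancel_left] at hval
      rw [← hzε] at hv he
      refine ⟨v, hv, ?_⟩
      rw [hval, he, sidePow_of_pos σ hε, sidePow_of_pos σ (by linarith [ht.1]),
        show -(α - β) = -α + β by ring]
    · obtain ⟨v, hv, he⟩ := hF.exists_isSideValue (β := β) (by ring) hA ha hσ (b := a - d)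
        (sub_nonneg.2 ht.1.le) (Or.inl (sub_pos.2 ht.1)) (bnd ht.2)
      rw [← hza] at hv he
      refine ⟨v, hv, ?_⟩
      rw [rlDeriv_powerFun hα₁ β d ht.1 (bnd ht.2), he, show -(α - β) = -α + β by ring]
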